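/- Let $\mathcal X$ be a smooth Riemannian manifold of dimension $n$ (Hausdorff, without boundary), write $|\delta x|$ for the Riemannian length of a tangent vector $\delta x$, and let $f$ be a $C^1$ vector field on $\mathcal X$. Let $\psi^t(x)$ be the value at time $t$ of the solution of $\dot x=f(x)$ that passes through $x$ at time $0$, and $\partial\psi^t(x)$ the differential of $\psi^t$ at $x$. A symmetric real $n\times n$ matrix has inertia $p$ if, counted with multiplicity, it has $p$ negative and $n-p$ positive eigenvalues. Suppose that the system $\dot x=f(x)$ is strictly $p$-dominant with rate $\lambda\ge 0$ and constant tensor $P$ of inertia $p$: there are a tensor field $P$ of bilinear forms on the tangent spaces, a symmetric matrix of inertia $p$, also denoted $P$, and a constant $\varepsilon>0$ such that $\mathcal X$ is covered by smooth charts in which the tensor is represented by the constant matrix $P$ and in which, for every $x$ in the chart and every $\delta x\in T_x\mathcal X$, $$\delta x^T\big(\partial f(x)^TP+P\,\partial f(x)\big)\delta x\le -2\lambda\,\delta x^TP\,\delta x-\varepsilon|\delta x|^2 ,$$ where $\partial f(x)$ is the Jacobian matrix of $f$ in the coordinates of the chart. Let $\mathcal A\subseteq\mathcal X$ be a compact invariant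 set, that is, for each $x\in\mathcal A$ the solution through $x$ exists for all $t\in\mathbb R$ and stays in $\mathcal A$. Then for each $x\in\mathcal A$ there is a splitting $T_x\mathcal X=\mathcal H_x\oplus\mathcal V_x$ with $\dim\mathcal H_x=p$ and $\dim\mathcal V_x=n-p$, which is invariant: $$\partial\psi^t(x)\mathcal H_x\subseteq\mathcal H_{\psi^t(x)},\qquad \partial\psi^t(x)\mathcal V_x\subseteq\mathcal V_{\psi^t(x)}\qquad\text{for all }t\in\mathbb R,\ x\in\mathcal A .$$ Moreover there are constants $0<\underline C\le 1\le\overline C$ and $\underline\lambda<\lambda<\overline\lambda$ such that, for all $x\in\mathcal A$ and all $t\ge 0$, $$|\partial\psi^t(x)\delta x|\ge\underline C\,e^{-\underline\lambda t}|\delta x|\quad\text{for all }\delta x\in\mathcal H_x,\qquad |\partial\psi^t(x)\delta x|\le\overline C\,e^{-\overline\lambda t}|\delta x|\quad\text{for all }\delta x\in\mathcal V_x .$$ -/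

import Mathlib

open Set Manifold
open scoped ContDiff Matrix

namespace Dominance

/-- The model space `ℝⁿ`, with its Euclidean inner product. -/
abbrev E (n : ℕ) : Type := EuclideanSpace ℝ (Fin n)

/-- A real matrix `P` of size `n` has inertia `p`, that is `(p, 0, n - p)`: it is symmetric, and,
counted with multiplicity, it has `p` negative and `n - p` positive eigenvalues. -/
def HasInertia {n : ℕ} (P : Matrix (Fin n) (Fin n) ℝ) (p : ℕ) : Prop :=
  ∃ hP : P.IsHermitian,
    (Finset.univ.filter fun i => hP.eigenvalues i < 0).card = p ∧
    (Finset.univ.filter fun i => 0 < hP.eigenvalues i).card = n - p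

/-- The bilinear form `vᵀ P w` of a matrix `P`. -/
noncomputable def form {n : ℕ} (P : Matrix (Fin n) (Fin n) ℝ) (v w : E n) : ℝ :=
  v.ofLp ⬝ᵥ (P *ᵥ w.ofLp)

section Manifold

variable {n : ℕ} {X : Type*} [TopologicalSpace X] [ChartedSpace (E n) X]

/-- The differential at `x` of a chart `φ`: it sends a tangent vector at `x` to its coordinates in
the chart. -/
noncomputable def coord (φ : OpenPartialHomeomorph X (E n)) (x : X) :
    TangentSpace 𝓘(ℝ, E n) x →L[ℝ] E n :=
  mfderiv 𝓘(ℝ, E n) 𝓘(ℝ, E n) φ x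

/-- A vector field `f` read in the chart `φ`, as a map `ℝⁿ → ℝⁿ` (meaningful on `φ.target`). -/
noncomputable def localField (f : ∀ x : X, TangentSpace 𝓘(ℝ, E n) x)
    (φ : OpenPartialHomeomorph X (E n)) (ξ : E n) : E n :=
  coord φ (φ.symm ξ) (f (φ.symm ξ))

/-- The matrix `∂f(x)` of the linearized dynamics, in the coordinates of the chart `φ`. -/
noncomputable def linearization (f : ∀ x : X, TangentSpace 𝓘(ℝ, E n) x)
    (φ : OpenPartialHomeomorph X (E n)) (x : X) : E n →L[ℝ] E n :=
  fderiv ℝ (localField f φ) (φ x)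

/-- `φ` is a smooth chart in whose coordinates the tensor field `T` is the constant matrix `P`. -/
def IsAdaptedChart (T : ∀ x : X, TangentSpace 𝓘(ℝ, E n) x →L[ℝ] TangentSpace 𝓘(ℝ, E n) x →L[ℝ] ℝ)
    (P : Matrix (Fin n) (Fin n) ℝ) (φ : OpenPartialHomeomorph X (E n)) : Prop :=
  φ ∈ IsManifold.maximalAtlas 𝓘(ℝ, E n) ∞ X ∧
    ∀ y ∈ φ.source, ∀ u v : TangentSpace 𝓘(ℝ, E n) y,
      T y u v = form P (coord φ y u) (coord φ y v)

/-- A Riemannian metric of class `C^∞` on `X`. -/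
abbrev RiemMetric (n : ℕ) (X : Type*) [TopologicalSpace X] [ChartedSpace (E n) X]
    [IsManifold 𝓘(ℝ, E n) ∞ X] :=
  Bundle.ContMDiffRiemannianMetric 𝓘(ℝ, E n) ∞ (E n) (fun x : X => TangentSpace 𝓘(ℝ, E n) x)

/-- The Riemannian length `|u|` of a tangent vector. -/
noncomputable def len [IsManifold 𝓘(ℝ, E n) ∞ X] (g : RiemMetric n X) {x : X}
    (u : TangentSpace 𝓘(ℝ, E n) x) : ℝ :=
  Real.sqrt (g.inner x u u)

/-- The differential dissipation inequality with rate `lam` and constant `ε`, in a chart `φ` in which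
the tensor is the constant matrix `P`. Writing `δx` for the coordinates of a tangent vector and
`δx' = ∂f(x) δx` for its derivative along the prolonged system `x' = f(x)`, `δx' = ∂f(x) δx`,
it says `δx'ᵀ P δx + δxᵀ P δx' + 2 lam δxᵀ P δx + ε |δx|² ≤ 0`. -/
def Dissipation [IsManifold 𝓘(ℝ, E n) ∞ X] (g : RiemMetric n X)
    (f : ∀ x : X, TangentSpace 𝓘(ℝ, E n) x) (P : Matrix (Fin n) (Fin n) ℝ) (lam ε : ℝ)
    (φ : OpenPartialHomeomorph X (E n)) : Prop :=
  ∀ x ∈ φ.source, ∀ u : TangentSpace 𝓘(ℝ, E n) x,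
    form P (linearization f φ x (coord φ x u)) (coord φ x u) +
      form P (coord φ x u) (linearization f φ x (coord φ x u)) +
      2 * lam * form P (coord φ x u) (coord φ x u) + ε * len g u ^ 2 ≤ 0

/-- The system `x' = f(x)` is strictly `p`-dominant with rate `lam` and constant tensor `T` of
inertia `p`: for one symmetric matrix `P` of inertia `p` and one `ε > 0`, the manifold is covered by
local coordinates in which `T` is the constant matrix `P` and the dissipation inequality holds.
(The inequality does not depend on which of the adapted coordinates are used: the changes of
coordinates between them are locally affine.) -/
def StrictlyDominant [IsManifold 𝓘(ℝ, E n) ∞ X] (g : RiemMetric n X)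
    (f : ∀ x : X, TangentSpace 𝓘(ℝ, E n) x) (p : ℕ) (lam : ℝ)
    (T : ∀ x : X, TangentSpace 𝓘(ℝ, E n) x →L[ℝ] TangentSpace 𝓘(ℝ, E n) x →L[ℝ] ℝ) : Prop :=
  0 ≤ lam ∧ ∃ (P : Matrix (Fin n) (Fin n) ℝ) (ε : ℝ), HasInertia P p ∧ 0 < ε ∧
    ∀ x : X, ∃ φ : OpenPartialHomeomorph X (E n), x ∈ φ.source ∧
      IsAdaptedChart T P φ ∧ Dissipation g f P lam ε φ

/-- `y` is the value at time `t` of the solution of `x' = f(x)` that passes through `x` at time `0`: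
some integral curve, on an open interval containing `0` and `t`, goes from `x` to `y`. -/
def Reaches (f : ∀ x : X, TangentSpace 𝓘(ℝ, E n) x) (t : ℝ) (x y : X) : Prop :=
  ∃ (γ : ℝ → X) (a b : ℝ), 0 ∈ Ioo a b ∧ t ∈ Ioo a b ∧
    IsMIntegralCurveOn (I := 𝓘(ℝ, E n)) γ f (Ioo a b) ∧ γ 0 = x ∧ γ t = y

open Classical in
/-- The flow `ψᵗ(x)` of `x' = f(x)`. Where the solution through `x` does not exist up to time `t`,
the value is the irrelevant `x`. -/
noncomputable def flow (f : ∀ x : X, TangentSpace 𝓘(ℝ, E n) x) (t : ℝ) (x : X) : X :=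
  if h : ∃ y, Reaches f t x y then h.choose else x

/-- The differential `∂ψᵗ(x)` of the flow with respect to `x`. -/
noncomputable def dflow (f : ∀ x : X, TangentSpace 𝓘(ℝ, E n) x) (t : ℝ) (x : X) :
    TangentSpace 𝓘(ℝ, E n) x →L[ℝ] TangentSpace 𝓘(ℝ, E n) (flow f t x) :=
  mfderiv 𝓘(ℝ, E n) 𝓘(ℝ, E n) (flow f t) x

/-- `A` is invariant: the solution through any point of `A` exists for all times `t ∈ ℝ` and stays
in `A`. -/
def IsInvariant (f : ∀ x : X, TangentSpace 𝓘(ℝ, E n) x) (A : Set X) : Prop :=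
  ∀ x ∈ A, ∀ t : ℝ, (∃ y, Reaches f t x y) ∧ flow f t x ∈ A

end Manifold

end Dominance

/-!
The differential of the flow along `A` is a linear cocycle `D` over the flow, and dominance says that
along it the quadratic form `q` of the tensor satisfies `q' ≤ -2 lam q - ε |u|²`. Hence
`exp (2 lam t) q` decreases along every orbit of `D`, so the cones `{q ≥ 0}` are mapped into themselves
in backward time and the cones `{q ≤ 0}` in forward time. Let `V x` consist of the vectors `u` with
`exp (lam t) |D t u| → 0` as `t → ∞`, and `H x` of those with the same property as `t → -∞`. Both are
invariant subspaces. A vector lies in `V x` exactly when `q` stays nonnegative along its whole orbit: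
then `q`, which is dominated by `|u|²`, decays at a rate above `2 lam` by Grönwall's inequality, and
the loss of `exp (2 lam t) q` over a short window controls the length (`le_exp_mul_of_dissipation`).

For the dimensions, `V x` contains the intersection of the decreasing cones `{u | q (D k u) ≥ 0}`,
`k ∈ ℕ`. Each of them contains a subspace of dimension `n - p`, the preimage under `D k` of one on
which `q` is nonnegative, and by compactness of the set of orthonormal frames so does the intersection
(`exists_submodule_forall_nonneg`). Reversing time and the signs of `q` and `lam` exchanges `V` and
`H` (`IsDissipativeCocycle.reverse`), so `H x` has dimension at least `p` and its vectors contract in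
backward time. The two rates give `H x ∩ V x = 0`, and counting dimensions gives the splitting
(`IsDissipativeCocycle.isCompl_stable`).

That `D` is such a cocycle needs the flow to be differentiable in the initial point, with the solution
of the variational equation as its derivative. This is shown in coordinates by Grönwall's inequality
(`exists_localFlow`), carried over to the manifold (`exists_flow_chart`), and extended from short times
to all times by composition. The uniform constants come from the compactness of `A` and the local
comparison of the Riemannian length with that of coordinates (`exists_norm_coord_le_inner`).
-/

namespace Dominance

open Filter Topology Metric
open scoped NNReal

/-! ### Local flows of `C¹` vector fields -/

section LocalFlow

variable {F : Type*} [NormedAddCommGroup F] [NormedSpace ℝ F]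

/-- A two-sided Grönwall inequality with vanishing initial value. -/
theorem norm_le_of_norm_deriv_le {z z' : ℝ → F} {δ K ε : ℝ} (hK : 0 < K) (hε : 0 ≤ ε)
    (hz : ∀ t ∈ Ioo (-δ) δ, HasDerivAt z (z' t) t) (h0 : z 0 = 0)
    (hb : ∀ t ∈ Ioo (-δ) δ, ‖z' t‖ ≤ K * ‖z t‖ + ε) :
    ∀ t ∈ Ioo (-δ) δ, ‖z t‖ ≤ ε / K * Real.exp (K * δ) := by
  have forward : ∀ (w w' : ℝ → F), (∀ t ∈ Ioo (-δ) δ, HasDerivAt w (w' t) t) → w 0 = 0 →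
      (∀ t ∈ Ioo (-δ) δ, ‖w' t‖ ≤ K * ‖w t‖ + ε) →
      ∀ t ∈ Ico 0 δ, ‖w t‖ ≤ ε / K * Real.exp (K * δ) := by
    intro w w' hw hw0 hwb t ht
    have hsub : ∀ s ∈ Icc 0 t, s ∈ Ioo (-δ) δ := fun s hs =>
      ⟨by linarith [hs.1, ht.1, ht.2], by linarith [hs.2, ht.2]⟩
    have := norm_le_gronwallBound_of_norm_deriv_right_le (f := w) (f' := w') (δ := 0) (K := K)
      (ε := ε) (a := 0) (b := t)
      (fun s hs => (hw s (hsub s hs)).continuousAt.continuousWithinAt)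
      (fun s hs => (hw s (hsub s (Ico_subset_Icc_self hs))).hasDerivWithinAt) (by simp [hw0])
      (fun s hs => hwb s (hsub s (Ico_subset_Icc_self hs))) t ⟨ht.1, le_rfl⟩
    rw [gronwallBound_of_K_ne_0 hK.ne'] at this
    have h1 : Real.exp (K * (t - 0)) ≤ Real.exp (K * δ) := by
      apply Real.exp_le_exp.2
      have := ht.2.le
      gcongr
      linarith
    have h2 : 0 ≤ ε / K := by positivity
    nlinarith
  intro t ht
  rcases le_total 0 t with h | h
  · exact forward z z' hz h0 hb t ⟨h, ht.2⟩
  · have hneg : ∀ s ∈ Ioo (-δ) δ, -s ∈ Ioo (-δ) δ := fun s hs =>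
      ⟨by linarith [hs.2], by linarith [hs.1]⟩
    have := forward (fun s => z (-s)) (fun s => -z' (-s))
      (fun s hs => by
        simpa [Function.comp_def] using (hz (-s) (hneg s hs)).scomp s (hasDerivAt_neg s))
      (by simpa using h0) (fun s hs => by simpa using hb (-s) (hneg s hs)) (-t)
      ⟨by linarith, by linarith [ht.1]⟩
    simpa using this

variable [CompleteSpace F]

/-- A linear equation `M' = A(t) M` with `‖A‖ ≤ K` has a solution with `M(0) = 1` on any interval
`[-δ, δ]` so short that the Picard iteration stays within distance `1` of the identity. -/
theorem exists_fundamental_solution {A : ℝ → F →L[ℝ] F} {K : ℝ≥0} {δ : ℝ} (hδ : 0 < δ)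
    (hA : ContinuousOn A (Icc (-δ) δ)) (hK : ∀ t ∈ Icc (-δ) δ, ‖A t‖ ≤ K) (hKδ : K * 2 * δ ≤ 1) :
    ∃ M : ℝ → F →L[ℝ] F, M 0 = ContinuousLinearMap.id ℝ F ∧
      ∀ t ∈ Ioo (-δ) δ, HasDerivAt M ((A t).comp (M t)) t := by
  have h0 : (0 : ℝ) ∈ Icc (-δ) δ := ⟨by linarith, hδ.le⟩
  have hpl : IsPicardLindelof (fun t (B : F →L[ℝ] F) => (A t).comp B) (tmin := -δ) (tmax := δ)
      ⟨0, h0⟩ (ContinuousLinearMap.id ℝ F) 1 0 (K * 2) K := by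
    refine ⟨fun t ht => LipschitzOnWith.of_dist_le_mul fun B _ C _ => ?_, fun B _ => ?_,
      fun t ht B hB => ?_, ?_⟩
    · rw [dist_eq_norm, dist_eq_norm, ← ContinuousLinearMap.comp_sub]
      exact (ContinuousLinearMap.opNorm_comp_le _ _).trans (by gcongr; exact hK t ht)
    · exact hA.clm_comp continuousOn_const
    · refine (ContinuousLinearMap.opNorm_comp_le _ _).trans ?_
      have h1 : ‖B‖ ≤ 2 := by
        have h2 := norm_le_norm_add_norm_sub' B (ContinuousLinearMap.id ℝ F)
        have h3 : ‖ContinuousLinearMap.id ℝ F‖ ≤ 1 := ContinuousLinearMap.norm_id_le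
        have h4 : ‖B - ContinuousLinearMap.id ℝ F‖ ≤ 1 := by
          simpa [dist_eq_norm] using hB
        linarith
      push_cast
      gcongr
      exact hK t ht
    · simpa using hKδ
  obtain ⟨M, hM0, hM⟩ := hpl.exists_eq_forall_mem_Icc_hasDerivWithinAt₀
  exact ⟨M, hM0, fun t ht =>
    (hM t (Ioo_subset_Icc_self ht)).hasDerivAt (Icc_mem_nhds ht.1 ht.2)⟩

/-- A `C¹` vector field near a point of a finite-dimensional space has a local flow `Φ` which is
differentiable in the initial value; the derivative `M` is the fundamental solution of the
variational equation along the trajectory. -/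
theorem exists_localFlow [FiniteDimensional ℝ F] {f : F → F} {ξ₀ : F} (hf : ContDiffAt ℝ 1 f ξ₀)
    {U : Set F} (hU : U ∈ 𝓝 ξ₀) :
    ∃ r > 0, ∃ δ > 0, ∃ (L : ℝ≥0) (Φ : F → ℝ → F) (M : F → ℝ → F →L[ℝ] F), ∀ ξ ∈ ball ξ₀ r,
      Φ ξ 0 = ξ ∧ M ξ 0 = ContinuousLinearMap.id ℝ F ∧ HasDerivAt (M ξ) (fderiv ℝ f ξ) 0 ∧
      ∀ t ∈ Ioo (-δ) δ, Φ ξ t ∈ U ∧ HasDerivAt (Φ ξ) (f (Φ ξ t)) t ∧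
        HasFDerivAt (Φ · t) (M ξ t) ξ ∧ ‖M ξ t‖ ≤ L := by
  have : ProperSpace F := FiniteDimensional.proper ℝ F
  obtain ⟨a, ha, haU⟩ : ∃ a > 0, closedBall ξ₀ a ⊆ {x | ContDiffAt ℝ 1 f x} ∩ U :=
    nhds_basis_closedBall.mem_iff.1 (inter_mem (hf.eventually (by simp)) hU)
  set B := closedBall ξ₀ a
  have hC : ∀ x ∈ B, ContDiffAt ℝ 1 f x := fun x hx => by simpa using (haU hx).1
  have hBc : IsCompact B := isCompact_closedBall _ _
  have hdf : ContinuousOn (fderiv ℝ f) B := fun x hx =>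
    ((hC x hx).continuousAt_fderiv one_ne_zero).continuousWithinAt
  obtain ⟨K₀, hK₀⟩ := hBc.exists_bound_of_continuousOn hdf
  set K : ℝ≥0 := Real.toNNReal K₀ + 1
  have hKpos : (0 : ℝ) < K := by positivity
  have hK : ∀ x ∈ B, ‖fderiv ℝ f x‖ ≤ K := fun x hx => by
    have := (hK₀ x hx).trans (Real.le_coe_toNNReal K₀)
    simp only [K, NNReal.coe_add, NNReal.coe_one]
    linarith
  have huc := hBc.uniformContinuousOn_of_continuous hdf
  obtain ⟨ε, hε, _, r₀, _, _, hr₀, hpl⟩ := IsPicardLindelof.of_contDiffAt_one hf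
  obtain ⟨Φ, hΦ, L, hL⟩ :=
    (hpl 0).exists_forall_mem_closedBall_eq_hasDerivWithinAt_lipschitzOnWith
  simp only [zero_sub, zero_add] at hΦ hL
  have hcont : ContinuousOn (Function.uncurry Φ) (closedBall ξ₀ r₀ ×ˢ Icc (-ε) ε) :=
    continuousOn_prod_of_continuousOn_lipschitzOnWith _ L
      (fun x hx => HasDerivWithinAt.continuousOn (hΦ x hx).2) hL
  have hξ₀ : ξ₀ ∈ closedBall ξ₀ (r₀ : ℝ) := mem_closedBall_self r₀.2
  -- by continuity, short trajectories from points near `ξ₀` stay in `B`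
  have hev : ∀ᶠ q : F × ℝ in 𝓝 ξ₀ ×ˢ 𝓝 0,
      q.1 ∈ ball ξ₀ (r₀ : ℝ) ∧ q.2 ∈ Ioo (-ε) ε ∧ Φ q.1 q.2 ∈ B := by
    have h1 : closedBall ξ₀ (r₀ : ℝ) ×ˢ Icc (-ε) ε ∈ 𝓝 (ξ₀, (0 : ℝ)) :=
      prod_mem_nhds (closedBall_mem_nhds _ hr₀) (Icc_mem_nhds (by linarith) hε)
    have h2 := (hcont.continuousAt h1).preimage_mem_nhds
      (show B ∈ 𝓝 (Function.uncurry Φ (ξ₀, 0)) by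
        simpa [Function.uncurry, (hΦ ξ₀ hξ₀).1] using closedBall_mem_nhds ξ₀ ha)
    rw [← nhds_prod_eq]
    filter_upwards [h2, prod_mem_nhds (ball_mem_nhds ξ₀ hr₀)
      (Ioo_mem_nhds (show -ε < 0 by linarith) hε)] with q hq hq'
    exact ⟨hq'.1, hq'.2, hq⟩
  obtain ⟨r, hr, δ₁, hδ₁, hball⟩ : ∃ r > 0, ∃ δ > 0, ∀ ξ ∈ ball ξ₀ r, ∀ t ∈ ball (0 : ℝ) δ,
      ξ ∈ ball ξ₀ (r₀ : ℝ) ∧ t ∈ Ioo (-ε) ε ∧ Φ ξ t ∈ B := by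
    obtain ⟨S, hS, S', hS', h⟩ := eventually_prod_iff.1 hev
    obtain ⟨r, hr, hrS⟩ := Metric.eventually_nhds_iff_ball.1 hS
    obtain ⟨δ, hδ, hδS⟩ := Metric.eventually_nhds_iff_ball.1 hS'
    exact ⟨r, hr, δ, hδ, fun ξ hξ t ht => h (hrS ξ hξ) (hδS t ht)⟩
  obtain ⟨δ, hδ, hδ1, hδ2⟩ : ∃ δ > 0, δ < δ₁ ∧ (K : ℝ) * 2 * δ ≤ 1 := by
    refine ⟨min (δ₁ / 2) (1 / (K * 2)), by positivity, by
      linarith [min_le_left (δ₁ / 2) (1 / ((K : ℝ) * 2))], ?_⟩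
    calc (K : ℝ) * 2 * min (δ₁ / 2) (1 / (K * 2)) ≤ K * 2 * (1 / (K * 2)) := by
          gcongr; exact min_le_right _ _
      _ = 1 := by field_simp
  have hIcc : ∀ t ∈ Icc (-δ) δ, t ∈ ball (0 : ℝ) δ₁ := fun t ht => by
    rw [mem_ball_zero_iff, Real.norm_eq_abs, abs_lt]
    exact ⟨by linarith [ht.1], by linarith [ht.2]⟩
  have hderiv : ∀ ξ ∈ ball ξ₀ r, ∀ t ∈ Icc (-δ) δ, HasDerivAt (Φ ξ) (f (Φ ξ t)) t := by
    intro ξ hξ t ht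
    obtain ⟨h1, h2, -⟩ := hball ξ hξ t (hIcc t ht)
    exact ((hΦ ξ (ball_subset_closedBall h1)).2 t (Ioo_subset_Icc_self h2)).hasDerivAt
      (Icc_mem_nhds h2.1 h2.2)
  have hlip : ∀ t ∈ Icc (-δ) δ, LipschitzOnWith L (Φ · t) (ball ξ₀ r) := fun t ht =>
    (hL t (Ioo_subset_Icc_self (hball ξ₀ (mem_ball_self hr) t (hIcc t ht)).2.1)).mono
      fun ξ hξ => ball_subset_closedBall (hball ξ hξ t (hIcc t ht)).1
  have hinit : ∀ ξ ∈ ball ξ₀ r, Φ ξ 0 = ξ := fun ξ hξ =>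
    (hΦ ξ (ball_subset_closedBall (hball ξ hξ 0 (mem_ball_self hδ₁)).1)).1
  have hM : ∀ ξ, ∃ M : ℝ → F →L[ℝ] F, ξ ∈ ball ξ₀ r → M 0 = ContinuousLinearMap.id ℝ F ∧
      ∀ t ∈ Ioo (-δ) δ, HasDerivAt M ((fderiv ℝ f (Φ ξ t)).comp (M t)) t := by
    intro ξ
    by_cases hξ : ξ ∈ ball ξ₀ r
    · obtain ⟨M, hM⟩ := exists_fundamental_solution (A := fun t => fderiv ℝ f (Φ ξ t)) hδ
        (hdf.comp (fun t ht => (hderiv ξ hξ t ht).continuousAt.continuousWithinAt)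
          fun t ht => (hball ξ hξ t (hIcc t ht)).2.2)
        (fun t ht => hK _ (hball ξ hξ t (hIcc t ht)).2.2) hδ2
      exact ⟨M, fun _ => hM⟩
    · exact ⟨0, fun h => absurd h hξ⟩
  choose M hM using hM
  refine ⟨r, hr, δ, hδ, L, Φ, M, fun ξ hξ => ⟨hinit ξ hξ, (hM ξ hξ).1, ?_, fun t ht => ?_⟩⟩
  · have := (hM ξ hξ).2 0 ⟨by linarith, hδ⟩
    rw [(hM ξ hξ).1, hinit ξ hξ] at this
    simpa using this
  have hfd : HasFDerivAt (Φ · t) (M ξ t) ξ := by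
    rw [hasFDerivAt_iff_isLittleO, Asymptotics.isLittleO_iff]
    intro c hc
    set η : ℝ := c / (L + 1) * (K / Real.exp (K * δ))
    have hη : 0 < η := by positivity
    obtain ⟨ρ, hρ, hρη⟩ := Metric.uniformContinuousOn_iff.1 huc η hη
    have hev : ∀ᶠ ξ' in 𝓝 ξ, ξ' ∈ ball ξ₀ r ∧ (L : ℝ) * ‖ξ' - ξ‖ < ρ := by
      refine (isOpen_ball.eventually_mem hξ).and ?_
      have : Tendsto (fun ξ' => (L : ℝ) * ‖ξ' - ξ‖) (𝓝 ξ) (𝓝 (L * ‖ξ - ξ‖)) :=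
        Continuous.tendsto (by fun_prop) _
      rw [sub_self, norm_zero, mul_zero] at this
      exact this.eventually_lt_const hρ
    filter_upwards [hev] with ξ' ⟨hξ', hd⟩
    have hdist : ∀ s ∈ Icc (-δ) δ, ‖Φ ξ' s - Φ ξ s‖ ≤ L * ‖ξ' - ξ‖ := fun s hs =>
      (hlip s hs).norm_sub_le hξ' hξ
    have hkey := norm_le_of_norm_deriv_le (z := fun s => Φ ξ' s - Φ ξ s - M ξ s (ξ' - ξ))
      (z' := fun s => f (Φ ξ' s) - f (Φ ξ s) - fderiv ℝ f (Φ ξ s) (M ξ s (ξ' - ξ)))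
      (δ := δ) (K := K) (ε := η * (L * ‖ξ' - ξ‖)) hKpos (by positivity)
      (fun s hs => by
        have hs' := Ioo_subset_Icc_self hs
        simpa using ((hderiv ξ' hξ' s hs').fun_sub (hderiv ξ hξ s hs')).fun_sub
          (((hM ξ hξ).2 s hs).clm_apply (hasDerivAt_const s (ξ' - ξ))))
      (by simp [hinit ξ hξ, hinit ξ' hξ', (hM ξ hξ).1])
      (fun s hs => by
        have hs' := Ioo_subset_Icc_self hs
        have hx := (hball ξ hξ s (hIcc s hs')).2.2
        have hy := (hball ξ' hξ' s (hIcc s hs')).2.2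
        have hxy := hdist s hs'
        have hmv : ‖f (Φ ξ' s) - f (Φ ξ s) - fderiv ℝ f (Φ ξ s) (Φ ξ' s - Φ ξ s)‖
            ≤ η * ‖Φ ξ' s - Φ ξ s‖ := by
          refine Convex.norm_image_sub_le_of_norm_hasFDerivWithin_le'
            (f' := fderiv ℝ f) (s := B ∩ ball (Φ ξ s) ρ) (fun x hx' => ?_) (fun x hx' => ?_)
            ((convex_closedBall _ _).inter (convex_ball _ _)) ⟨hx, mem_ball_self hρ⟩ ⟨hy, ?_⟩
          · exact (((hC x hx'.1).differentiableAt one_ne_zero).hasFDerivAt).hasFDerivWithinAt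
          · rw [← dist_eq_norm]
            exact (hρη x hx'.1 _ hx hx'.2).le
          · rw [mem_ball, dist_eq_norm]
            exact hxy.trans_lt hd
        have heq : f (Φ ξ' s) - f (Φ ξ s) - fderiv ℝ f (Φ ξ s) (M ξ s (ξ' - ξ)) =
            fderiv ℝ f (Φ ξ s) (Φ ξ' s - Φ ξ s - M ξ s (ξ' - ξ)) +
            (f (Φ ξ' s) - f (Φ ξ s) - fderiv ℝ f (Φ ξ s) (Φ ξ' s - Φ ξ s)) := by
          simp only [map_sub]
          abel
        rw [heq]
        refine (norm_add_le _ _).trans (add_le_add ?_ (hmv.trans (by gcongr)))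
        exact ((fderiv ℝ f (Φ ξ s)).le_opNorm _).trans (by gcongr; exact hK _ hx)) t ht
    refine hkey.trans ?_
    have : η * (L * ‖ξ' - ξ‖) / K * Real.exp (K * δ) = c * (L / (L + 1)) * ‖ξ' - ξ‖ := by
      simp only [η]
      field_simp
    rw [this]
    have h1 : (L : ℝ) / (L + 1) ≤ 1 := by
      rw [div_le_one (by positivity)]
      linarith
    have h2 : c * (L / (L + 1)) ≤ c := by nlinarith
    gcongr
  have ht' := Ioo_subset_Icc_self ht
  exact ⟨(haU (hball ξ hξ t (hIcc t ht')).2.2).2, hderiv ξ hξ t ht', hfd,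
    hfd.le_of_lipschitzOn (isOpen_ball.mem_nhds hξ) (hlip t ht')⟩

end LocalFlow

/-! ### Decay under dissipation, and limits of cones -/

section Cone

/-- If `R ≥ 0` decreases at least as fast as `ε a`, is dominated by `a`, and `a` has bounded growth on
short windows, then `a` decays exponentially: `R` decays by Grönwall's inequality, and the loss of
`R` over a short window controls `a`. -/
theorem le_exp_mul_of_dissipation {R R' a : ℝ → ℝ} {ε c K τ : ℝ} (hε : 0 < ε) (hc : 0 < c)
    (hτ : 0 < τ) (hK : 0 < K) (hR : ∀ t, HasDerivAt R (R' t) t) (hd : ∀ t, R' t ≤ -ε * a t)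
    (hRa : ∀ t, R t ≤ c * a t) (hKa : ∀ s t, |t - s| ≤ τ → a t ≤ K * a s)
    (hpos : ∀ t, 0 ≤ R t) {t : ℝ} (ht : 0 ≤ t) :
    a t ≤ c * K ^ 2 / (τ * ε) * Real.exp (-(ε / c) * t) * a 0 := by
  have hanti : Antitone fun t => Real.exp (ε / c * t) * R t := by
    refine antitone_of_hasDerivAt_nonpos
      (fun t => (((hasDerivAt_id t).const_mul (ε / c)).exp).mul (hR t)) fun t => ?_
    have h1 : ε / c * R t ≤ ε * a t := by
      calc ε / c * R t ≤ ε / c * (c * a t) := by gcongr; exact hRa t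
        _ = ε * a t := by field_simp
    have h2 := hd t
    have h3 := Real.exp_pos (ε / c * t)
    change Real.exp (ε / c * t) * (ε / c * 1) * R t + Real.exp (ε / c * t) * R' t ≤ 0
    nlinarith
  -- the loss of `R` over the preceding window of length `τ` controls `a t`
  have hwin : ε / K * a t * τ ≤ R (t - τ) - R t := by
    have := Convex.image_sub_le_mul_sub_of_deriv_le (convex_Icc (t - τ) t) (f := R)
      (fun s _ => (hR s).continuousAt.continuousWithinAt)
      (fun s _ => (hR s).differentiableAt.differentiableWithinAt) (C := -(ε / K * a t))
      (fun s hs => by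
        rw [interior_Icc] at hs
        rw [(hR s).deriv]
        refine (hd s).trans ?_
        have h1 := hKa s t (by rw [abs_le]; constructor <;> linarith [hs.1, hs.2])
        have : ε / K * a t ≤ ε / K * (K * a s) := by gcongr
        have h3 : ε / K * (K * a s) = ε * a s := by field_simp
        linarith) (t - τ) ⟨le_rfl, by linarith⟩ t ⟨by linarith, le_rfl⟩ (by linarith)
    linarith
  have h1 : R (t - τ) ≤ Real.exp (-(ε / c) * t) * (c * (K * a 0)) := by
    have h2 : R (-τ) ≤ c * (K * a 0) := (hRa _).trans (by
      gcongr
      exact hKa _ _ (by simp [abs_of_pos hτ]))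
    have h3 : Real.exp (ε / c * (t - τ)) * R (t - τ) ≤ Real.exp (ε / c * -τ) * R (-τ) :=
      hanti (by linarith)
    have h4 : R (t - τ) = Real.exp (-(ε / c * (t - τ))) *
        (Real.exp (ε / c * (t - τ)) * R (t - τ)) := by
      rw [← mul_assoc, ← Real.exp_add, neg_add_cancel, Real.exp_zero, one_mul]
    have h5 : Real.exp (-(ε / c) * t) * R (-τ) = Real.exp (-(ε / c * (t - τ))) *
        (Real.exp (ε / c * -τ) * R (-τ)) := by
      rw [← mul_assoc, ← Real.exp_add]
      ring_nf
    calc R (t - τ) ≤ Real.exp (-(ε / c) * t) * R (-τ) := by rw [h4, h5]; gcongr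
      _ ≤ _ := by gcongr
  have h2 : ε / K * a t * τ ≤ Real.exp (-(ε / c) * t) * (c * (K * a 0)) := by
    linarith [hpos t]
  calc a t = K / (τ * ε) * (ε / K * a t * τ) := by field_simp
    _ ≤ K / (τ * ε) * (Real.exp (-(ε / c) * t) * (c * (K * a 0))) := by gcongr
    _ = _ := by ring

/-- A decreasing sequence of closed cones (superlevel sets), each containing a subspace of dimension
`m`, has an `m`-dimensional subspace in its intersection: the orthonormal `m`-frames spanning such
subspaces form a decreasing sequence of nonempty compact sets. -/
theorem exists_submodule_forall_nonneg {W : Type*} [NormedAddCommGroup W] [InnerProductSpace ℝ W]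
    [FiniteDimensional ℝ W] {ρ : ℕ → W → ℝ} (hρ : ∀ k, Continuous (ρ k))
    (hanti : ∀ k u, ρ (k + 1) u ≤ ρ k u) {m : ℕ}
    (h : ∀ k, ∃ S : Submodule ℝ W, Module.finrank ℝ S = m ∧ ∀ u ∈ S, 0 ≤ ρ k u) :
    ∃ S : Submodule ℝ W, Module.finrank ℝ S = m ∧ ∀ u ∈ S, ∀ k, 0 ≤ ρ k u := by
  have : ProperSpace W := FiniteDimensional.proper ℝ W
  set frames : Set (Fin m → W) := {v | ∀ i j, inner ℝ (v i) (v j) = if i = j then (1 : ℝ) else 0}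
  set C : ℕ → Set (Fin m → W) := fun k =>
    frames ∩ {v | ∀ c : Fin m → ℝ, 0 ≤ ρ k (∑ i, c i • v i)}
  have hframes : IsClosed frames := by
    have : frames = ⋂ i, ⋂ j, {v | inner ℝ (v i) (v j) = if i = j then (1 : ℝ) else 0} := by
      ext; simp [frames]
    rw [this]
    exact isClosed_iInter fun i => isClosed_iInter fun j =>
      isClosed_eq (by fun_prop) continuous_const
  have hclosed : ∀ k, IsClosed (C k) := fun k => by
    refine hframes.inter ?_
    have : {v : Fin m → W | ∀ c : Fin m → ℝ, 0 ≤ ρ k (∑ i, c i • v i)} =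
        ⋂ c : Fin m → ℝ, {v | 0 ≤ ρ k (∑ i, c i • v i)} := by
      ext; simp
    rw [this]
    exact isClosed_iInter fun c =>
      isClosed_le continuous_const ((hρ k).comp (by fun_prop))
  have hcompact : IsCompact (C 0) := by
    refine IsCompact.of_isClosed_subset (isCompact_closedBall (0 : Fin m → W) 1) (hclosed 0) ?_
    intro v hv
    rw [mem_closedBall_zero_iff, pi_norm_le_iff_of_nonneg zero_le_one]
    intro i
    have h1 : inner ℝ (v i) (v i) = (1 : ℝ) := by
      have h2 : v ∈ frames := hv.1
      simp only [frames, mem_ofPred_eq] at h2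
      simpa using h2 i i
    rw [real_inner_self_eq_norm_sq] at h1
    nlinarith [norm_nonneg (v i)]
  have hne : ∀ k, (C k).Nonempty := fun k => by
    obtain ⟨S, hS, hSρ⟩ := h k
    let b := (stdOrthonormalBasis ℝ S).reindex (finCongr hS)
    refine ⟨fun i => (b i : W), ?_, ?_⟩
    · simp only [frames, mem_ofPred_eq]
      intro i j
      have := orthonormal_iff_ite.1 b.orthonormal i j
      simpa using this
    · simp only [mem_ofPred_eq]
      intro c
      exact hSρ _ (S.sum_mem fun i _ => S.smul_mem _ (b i).2)
  obtain ⟨v, hv⟩ := IsCompact.nonempty_iInter_of_sequence_nonempty_isCompact_isClosed C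
    (fun k v hv => by
      refine ⟨hv.1, ?_⟩
      have h2 := hv.2
      simp only [mem_ofPred_eq] at h2 ⊢
      exact fun c => (h2 c).trans (hanti k _)) hne hcompact hclosed
  rw [mem_iInter] at hv
  have horth : Orthonormal ℝ v := by
    have h2 : v ∈ frames := (hv 0).1
    simp only [frames, mem_ofPred_eq] at h2
    exact orthonormal_iff_ite.2 h2
  refine ⟨Submodule.span ℝ (range v), ?_, fun u hu k => ?_⟩
  · rw [finrank_span_eq_card horth.linearIndependent, Fintype.card_fin]
  · obtain ⟨c, rfl⟩ := (Submodule.mem_span_range_iff_exists_fun ℝ).1 hu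
    have h2 := (hv k).2
    simp only [mem_ofPred_eq] at h2
    exact h2 c

end Cone

/-! ### Dissipative cocycles and their splitting -/

section Cocycle

/-- A linear cocycle `D` over a flow `ψ` on an invariant set `A`, all tangent spaces being identified
with one vector space `W`, which dissipates the quadratic forms `q x` at rate `lam`:
`(d/dt) q ≤ -2 lam q - ε N`. Here `N x u` is the squared length of `u` at `x`, which dominates `q`
up to the factor `c` and grows along `D` by at most the factor `K` over times up to `τ`. -/
structure IsDissipativeCocycle {Y W : Type*} [NormedAddCommGroup W] [NormedSpace ℝ W]
    (A : Set Y) (ψ : ℝ → Y → Y) (D : ℝ → Y → W →L[ℝ] W) (N q : Y → W → ℝ)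
    (lam ε c K τ : ℝ) : Prop where
  eps_pos : 0 < ε
  c_pos : 0 < c
  K_pos : 0 < K
  tau_pos : 0 < τ
  mapsTo : ∀ x ∈ A, ∀ t, ψ t x ∈ A
  flow_zero : ∀ x ∈ A, ψ 0 x = x
  flow_add : ∀ x ∈ A, ∀ s t, ψ (s + t) x = ψ s (ψ t x)
  cocycle_zero : ∀ x ∈ A, D 0 x = ContinuousLinearMap.id ℝ W
  cocycle_add : ∀ x ∈ A, ∀ s t, D (s + t) x = (D s (ψ t x)).comp (D t x)
  length_pos : ∀ x u, u ≠ 0 → 0 < N x u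
  length_smul : ∀ x (r : ℝ) u, N x (r • u) = r ^ 2 * N x u
  length_add_le : ∀ x u v, N x (u + v) ≤ 2 * N x u + 2 * N x v
  continuous_form : ∀ x ∈ A, Continuous (q x)
  abs_form_le : ∀ x ∈ A, ∀ u, |q x u| ≤ c * N x u
  length_le : ∀ x ∈ A, ∀ u t, |t| ≤ τ → N (ψ t x) (D t x u) ≤ K * N x u
  dissipation : ∀ x ∈ A, ∀ u, ∃ d, HasDerivAt (fun t => q (ψ t x) (D t x u)) d 0 ∧
    d ≤ -(2 * lam) * q x u - ε * N x u

namespace IsDissipativeCocycle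

variable {Y W : Type*} [NormedAddCommGroup W] [NormedSpace ℝ W] {A : Set Y} {ψ : ℝ → Y → Y}
  {D : ℝ → Y → W →L[ℝ] W} {N q : Y → W → ℝ} {lam ε c K τ : ℝ} {x : Y} {u : W}

/-- Reversing time and the sign of the form turns a dissipative cocycle of rate `lam` into one of
rate `-lam`. -/
theorem reverse (h : IsDissipativeCocycle A ψ D N q lam ε c K τ) :
    IsDissipativeCocycle A (fun t => ψ (-t)) (fun t => D (-t)) N (fun x u => -q x u) (-lam) ε c K τ where
  __ := h
  mapsTo x hx t := h.mapsTo x hx _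
  flow_zero x hx := by simpa using h.flow_zero x hx
  flow_add x hx s t := by rw [← h.flow_add x hx, neg_add]
  cocycle_zero x hx := by simpa using h.cocycle_zero x hx
  cocycle_add x hx s t := by rw [← h.cocycle_add x hx, neg_add]
  continuous_form x hx := (h.continuous_form x hx).neg
  abs_form_le x hx u := by simpa using h.abs_form_le x hx u
  length_le x hx u t ht := h.length_le x hx u (-t) (by simpa using ht)
  dissipation x hx u := by
    obtain ⟨d, hd, hle⟩ := h.dissipation x hx u
    refine ⟨d, ?_, by linarith⟩
    have h0 : HasDerivAt (fun t => q (ψ t x) (D t x u)) d (-0) := by simpa using hd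
    simpa [Function.comp_def] using (h0.scomp 0 (hasDerivAt_neg 0)).fun_neg

theorem length_zero (h : IsDissipativeCocycle A ψ D N q lam ε c K τ) (x : Y) : N x 0 = 0 := by
  simpa using h.length_smul x 0 0

theorem length_nonneg (h : IsDissipativeCocycle A ψ D N q lam ε c K τ) (x : Y) (u : W) :
    0 ≤ N x u := by
  rcases eq_or_ne u 0 with rfl | hu
  · rw [h.length_zero]
  · exact (h.length_pos x u hu).le

/-- A function `N` of tangent vectors (the squared length, or the form) along the orbit of `u`,
weighted by `exp (2 lam t)`. -/
noncomputable def weightedLength (ψ : ℝ → Y → Y) (D : ℝ → Y → W →L[ℝ] W) (N : Y → W → ℝ)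
    (lam : ℝ) (x : Y) (u : W) (t : ℝ) : ℝ :=
  Real.exp (2 * lam * t) * N (ψ t x) (D t x u)

theorem weightedLength_zero (h : IsDissipativeCocycle A ψ D N q lam ε c K τ) (hx : x ∈ A) :
    weightedLength ψ D N lam x u 0 = N x u := by
  simp [weightedLength, h.flow_zero x hx, h.cocycle_zero x hx]

theorem weightedLength_nonneg (h : IsDissipativeCocycle A ψ D N q lam ε c K τ) (t : ℝ) :
    0 ≤ weightedLength ψ D N lam x u t :=
  mul_nonneg (Real.exp_pos _).le (h.length_nonneg _ _)

/-- The form along an orbit can be differentiated at any time, by the cocycle property. -/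
theorem exists_hasDerivAt_weightedLength
    (h : IsDissipativeCocycle A ψ D N q lam ε c K τ) (hx : x ∈ A) (t : ℝ) :
    ∃ d, HasDerivAt (weightedLength ψ D q lam x u) d t ∧
      d ≤ -ε * weightedLength ψ D N lam x u t := by
  obtain ⟨d, hd, hle⟩ := h.dissipation (ψ t x) (h.mapsTo x hx t) (D t x u)
  have h1 : HasDerivAt (fun s => q (ψ s x) (D s x u)) d t := by
    have h0 : HasDerivAt (fun s => q (ψ s (ψ t x)) (D s (ψ t x) (D t x u))) d (t - t) := by
      simpa using hd
    have h2 := h0.comp_sub_const t t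
    refine h2.congr_of_eventuallyEq (Eventually.of_forall fun s => ?_)
    have e1 := h.flow_add x hx (s - t) t
    have e2 := h.cocycle_add x hx (s - t) t
    rw [sub_add_cancel] at e1 e2
    simp only [e1, e2, ContinuousLinearMap.comp_apply]
  have h2 := (((hasDerivAt_id t).const_mul (2 * lam)).exp).mul h1
  refine ⟨_, h2, ?_⟩
  simp only [weightedLength, id]
  have := Real.exp_pos (2 * lam * t)
  nlinarith

theorem antitone_weightedLength (h : IsDissipativeCocycle A ψ D N q lam ε c K τ) (hx : x ∈ A) :
    Antitone (weightedLength ψ D q lam x u) := by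
  choose d hd hle using fun t => h.exists_hasDerivAt_weightedLength (u := u) hx t
  refine antitone_of_hasDerivAt_nonpos hd fun t => (hle t).trans ?_
  have := mul_nonneg h.eps_pos.le (h.weightedLength_nonneg (x := x) (u := u) t)
  show _ ≤ (0 : ℝ)
  linarith

theorem weightedLength_form_le (h : IsDissipativeCocycle A ψ D N q lam ε c K τ) (hx : x ∈ A)
    (t : ℝ) : |weightedLength ψ D q lam x u t| ≤ c * weightedLength ψ D N lam x u t := by
  simp only [weightedLength, abs_mul, abs_of_pos (Real.exp_pos _)]
  have := h.abs_form_le (ψ t x) (h.mapsTo x hx t) (D t x u)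
  calc _ ≤ Real.exp (2 * lam * t) * (c * N (ψ t x) (D t x u)) := by gcongr
    _ = _ := by ring

theorem weightedLength_le (h : IsDissipativeCocycle A ψ D N q lam ε c K τ) (hx : x ∈ A)
    {s t : ℝ} (hst : |t - s| ≤ τ) :
    weightedLength ψ D N lam x u t ≤
      K * Real.exp (2 * |lam| * τ) * weightedLength ψ D N lam x u s := by
  have e1 := h.flow_add x hx (t - s) s
  have e2 := h.cocycle_add x hx (t - s) s
  rw [sub_add_cancel] at e1 e2
  have h1 : N (ψ t x) (D t x u) ≤ K * N (ψ s x) (D s x u) := by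
    rw [e1, e2]
    exact h.length_le _ (h.mapsTo x hx s) _ _ hst
  have h2 : Real.exp (2 * lam * t) ≤ Real.exp (2 * |lam| * τ) * Real.exp (2 * lam * s) := by
    rw [← Real.exp_add, Real.exp_le_exp]
    have : lam * (t - s) ≤ |lam| * τ := (le_abs_self _).trans (by rw [abs_mul]; gcongr)
    linarith
  have h3 := h.length_nonneg (ψ s x) (D s x u)
  have h4 := h.K_pos
  have h5 := h.length_nonneg (ψ t x) (D t x u)
  calc weightedLength ψ D N lam x u t ≤
      (Real.exp (2 * |lam| * τ) * Real.exp (2 * lam * s)) * (K * N (ψ s x) (D s x u)) := by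
        unfold weightedLength; gcongr
    _ = _ := by unfold weightedLength; ring

/-- The subspace of vectors that contract faster than `exp (-lam t)` in forward time. -/
noncomputable def stable (h : IsDissipativeCocycle A ψ D N q lam ε c K τ) (x : Y) :
    Submodule ℝ W where
  carrier := {u | Tendsto (weightedLength ψ D N lam x u) atTop (𝓝 0)}
  zero_mem' := by
    rw [mem_ofPred_eq]
    refine tendsto_const_nhds.congr fun t => ?_
    simp [weightedLength, h.length_zero]
  add_mem' := by
    intro u v hu hv
    rw [mem_ofPred_eq] at hu hv ⊢
    refine squeeze_zero (fun t => h.weightedLength_nonneg t) (fun t => ?_)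
      (by simpa using (hu.const_mul 2).add (hv.const_mul 2))
    have := h.length_add_le (ψ t x) (D t x u) (D t x v)
    simp only [weightedLength, map_add]
    nlinarith [Real.exp_pos (2 * lam * t)]
  smul_mem' := by
    intro r u hu
    rw [mem_ofPred_eq] at hu ⊢
    have := hu.const_mul (r ^ 2)
    rw [mul_zero] at this
    refine this.congr fun t => ?_
    simp only [weightedLength, map_smul, h.length_smul]
    ring

theorem mem_stable (h : IsDissipativeCocycle A ψ D N q lam ε c K τ) :
    u ∈ h.stable x ↔ Tendsto (weightedLength ψ D N lam x u) atTop (𝓝 0) := by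
  rw [stable, Submodule.mem_mk, AddSubmonoid.mem_mk, AddSubsemigroup.mem_mk, mem_ofPred_eq]

/-- A weighted form that decreases to `0` is nonnegative. -/
theorem form_nonneg_of_mem_stable (h : IsDissipativeCocycle A ψ D N q lam ε c K τ) (hx : x ∈ A)
    (hu : u ∈ h.stable x) (t : ℝ) : 0 ≤ weightedLength ψ D q lam x u t := by
  have h1 : Tendsto (weightedLength ψ D q lam x u) atTop (𝓝 0) := by
    refine squeeze_zero_norm (fun t => ?_)
      (by simpa using (h.mem_stable.1 hu).const_mul c)
    exact h.weightedLength_form_le hx t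
  exact (h.antitone_weightedLength hx).le_of_tendsto h1 t

/-- The constant of the contraction estimate: `K exp (2 |lam| τ)` bounds the growth of the weighted
squared length over times up to `τ`. -/
noncomputable def contractionConst (lam ε c K τ : ℝ) : ℝ :=
  c * (K * Real.exp (2 * |lam| * τ)) ^ 2 / (τ * ε)

theorem length_le_of_form_nonneg (h : IsDissipativeCocycle A ψ D N q lam ε c K τ) (hx : x ∈ A)
    (hu : ∀ t, 0 ≤ weightedLength ψ D q lam x u t) {t : ℝ} (ht : 0 ≤ t) :
    N (ψ t x) (D t x u) ≤
      contractionConst lam ε c K τ * Real.exp (-(2 * lam + ε / c) * t) * N x u := by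
  choose d hd hle using fun t => h.exists_hasDerivAt_weightedLength (u := u) hx t
  have h4 := h.K_pos
  have h1 := le_exp_mul_of_dissipation h.eps_pos h.c_pos h.tau_pos
    (K := K * Real.exp (2 * |lam| * τ)) (by positivity) hd hle
    (fun t => (le_abs_self _).trans (h.weightedLength_form_le hx t))
    (fun s t hst => h.weightedLength_le hx hst) hu ht
  rw [h.weightedLength_zero hx] at h1
  have h2 : N (ψ t x) (D t x u) = Real.exp (-(2 * lam * t)) * weightedLength ψ D N lam x u t := by
    rw [weightedLength, ← mul_assoc, ← Real.exp_add, neg_add_cancel, Real.exp_zero, one_mul]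
  have h3 : Real.exp (-(2 * lam + ε / c) * t) =
      Real.exp (-(2 * lam * t)) * Real.exp (-(ε / c) * t) := by
    rw [← Real.exp_add]; ring_nf
  rw [h2, h3, contractionConst]
  calc _ ≤ Real.exp (-(2 * lam * t)) * _ := mul_le_mul_of_nonneg_left h1 (Real.exp_pos _).le
    _ = _ := by ring

theorem mem_stable_of_form_nonneg (h : IsDissipativeCocycle A ψ D N q lam ε c K τ) (hx : x ∈ A)
    (hu : ∀ t, 0 ≤ weightedLength ψ D q lam x u t) : u ∈ h.stable x := by
  rw [h.mem_stable]
  have hpos : 0 < ε / c := div_pos h.eps_pos h.c_pos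
  have hlim : Tendsto (fun t => contractionConst lam ε c K τ * N x u * Real.exp (-(ε / c * t)))
      atTop (𝓝 0) := by
    have := (Real.tendsto_exp_neg_atTop_nhds_zero.comp
      (tendsto_id.const_mul_atTop hpos)).const_mul (contractionConst lam ε c K τ * N x u)
    simpa [Function.comp_def] using this
  refine squeeze_zero' (Eventually.of_forall fun t => h.weightedLength_nonneg t) ?_ hlim
  filter_upwards [eventually_ge_atTop 0] with t ht
  have h1 := h.length_le_of_form_nonneg hx hu ht
  have h3 : Real.exp (-(2 * lam + ε / c) * t) =
      Real.exp (-(2 * lam * t)) * Real.exp (-(ε / c * t)) := by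
    rw [← Real.exp_add]; ring_nf
  have h4 : Real.exp (2 * lam * t) * Real.exp (-(2 * lam * t)) = 1 := by
    rw [← Real.exp_add, add_neg_cancel, Real.exp_zero]
  rw [h3] at h1
  calc weightedLength ψ D N lam x u t ≤ Real.exp (2 * lam * t) * _ :=
        mul_le_mul_of_nonneg_left h1 (Real.exp_pos _).le
    _ = (Real.exp (2 * lam * t) * Real.exp (-(2 * lam * t))) *
        (contractionConst lam ε c K τ * N x u * Real.exp (-(ε / c * t))) := by ring
    _ = _ := by rw [h4, one_mul]

theorem length_le_of_mem_stable (h : IsDissipativeCocycle A ψ D N q lam ε c K τ) (hx : x ∈ A)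
    (hu : u ∈ h.stable x) {t : ℝ} (ht : 0 ≤ t) :
    N (ψ t x) (D t x u) ≤
      contractionConst lam ε c K τ * Real.exp (-(2 * lam + ε / c) * t) * N x u :=
  h.length_le_of_form_nonneg hx (h.form_nonneg_of_mem_stable hx hu) ht

theorem map_mem_stable (h : IsDissipativeCocycle A ψ D N q lam ε c K τ) (hx : x ∈ A)
    (hu : u ∈ h.stable x) (t : ℝ) : D t x u ∈ h.stable (ψ t x) := by
  rw [h.mem_stable] at hu ⊢
  have := (hu.comp (tendsto_atTop_add_const_right atTop t tendsto_id)).const_mul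
    (Real.exp (-(2 * lam * t)))
  rw [mul_zero] at this
  refine this.congr fun s => ?_
  simp only [weightedLength, Function.comp_apply, id, h.flow_add x hx s t, h.cocycle_add x hx s t,
    ContinuousLinearMap.comp_apply]
  rw [← mul_assoc, ← Real.exp_add]
  ring_nf

theorem map_mem_stable_reverse (h : IsDissipativeCocycle A ψ D N q lam ε c K τ) (hx : x ∈ A)
    (hu : u ∈ h.reverse.stable x) (t : ℝ) : D t x u ∈ h.reverse.stable (ψ t x) := by
  simpa using h.reverse.map_mem_stable hx hu (-t)

/-- Vectors that contract in backward time expand in forward time. -/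
theorem length_le_of_mem_stable_reverse (h : IsDissipativeCocycle A ψ D N q lam ε c K τ)
    (hx : x ∈ A) (hu : u ∈ h.reverse.stable x) {t : ℝ} (ht : 0 ≤ t) :
    N x u ≤ contractionConst (-lam) ε c K τ * Real.exp (-(2 * -lam + ε / c) * t) *
      N (ψ t x) (D t x u) := by
  have h1 := h.reverse.length_le_of_mem_stable (h.mapsTo x hx t)
    (h.map_mem_stable_reverse hx hu t) ht
  have h2 := h.cocycle_add x hx (-t) t
  rw [neg_add_cancel, h.cocycle_zero x hx] at h2
  have h3 : D (-t) (ψ t x) (D t x u) = u := (DFunLike.congr_fun h2 u).symm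
  rwa [h3, ← h.flow_add x hx, neg_add_cancel, h.flow_zero x hx] at h1

/-- Pulling back along the cocycle, at ever later times, subspaces on which the form is nonnegative
yields decreasing cones with a common subspace of the same dimension. -/
theorem exists_submodule_le_stable {W : Type*} [NormedAddCommGroup W] [InnerProductSpace ℝ W]
    [FiniteDimensional ℝ W] {D : ℝ → Y → W →L[ℝ] W} {N q : Y → W → ℝ}
    (h : IsDissipativeCocycle A ψ D N q lam ε c K τ) {m : ℕ}
    (hm : ∀ x ∈ A, ∃ S : Submodule ℝ W, Module.finrank ℝ S = m ∧ ∀ u ∈ S, 0 ≤ q x u)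
    (hx : x ∈ A) :
    ∃ S : Submodule ℝ W, Module.finrank ℝ S = m ∧ S ≤ h.stable x := by
  obtain ⟨S, hS, hSq⟩ := exists_submodule_forall_nonneg (W := W) (m := m)
    (ρ := fun k u => weightedLength ψ D q lam x u k)
    (fun k => by
      unfold weightedLength
      exact continuous_const.mul
        ((h.continuous_form _ (h.mapsTo x hx _)).comp (D _ x).continuous))
    (fun k u => h.antitone_weightedLength hx (by push_cast; linarith))
    (fun k => by
      obtain ⟨S, hS, hSq⟩ := hm (ψ k x) (h.mapsTo x hx _)
      have hinv : ∀ y ∈ A, ∀ t v, D (-t) (ψ t y) (D t y v) = v := by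
        intro y hy t v
        have := h.cocycle_add y hy (-t) t
        rw [neg_add_cancel, h.cocycle_zero y hy] at this
        exact (DFunLike.congr_fun this v).symm
      have hback : ψ (-(k : ℝ)) (ψ k x) = x := by
        rw [← h.flow_add x hx, neg_add_cancel, h.flow_zero x hx]
      refine ⟨S.map (D (-(k : ℝ)) (ψ k x)).toLinearMap, ?_, ?_⟩
      · rw [← hS]
        refine (Submodule.equivMapOfInjective _ (Function.LeftInverse.injective
          (g := D k (ψ (-(k : ℝ)) (ψ k x))) fun v => ?_) S).finrank_eq.symm
        simpa using hinv (ψ k x) (h.mapsTo x hx _) (-(k : ℝ)) v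
      · rintro _ ⟨v, hv, rfl⟩
        have := hinv (ψ k x) (h.mapsTo x hx _) (-(k : ℝ)) v
        rw [neg_neg, hback] at this
        simp only [weightedLength, ContinuousLinearMap.coe_coe, this]
        exact mul_nonneg (Real.exp_pos _).le (hSq v hv))
  refine ⟨S, hS, fun u hu => h.mem_stable_of_form_nonneg hx fun t => ?_⟩
  obtain ⟨k, hk⟩ := exists_nat_ge t
  exact (hSq u hu k).trans (h.antitone_weightedLength hx hk)

/-- The forward contracting subspace and its counterpart in backward time split the space, by the
count of dimensions: their intersection is trivial as vectors of the latter expand relative to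
`exp (-lam t)` in forward time. -/
theorem isCompl_stable {W : Type*} [NormedAddCommGroup W] [InnerProductSpace ℝ W]
    [FiniteDimensional ℝ W] {D : ℝ → Y → W →L[ℝ] W} {N q : Y → W → ℝ}
    (h : IsDissipativeCocycle A ψ D N q lam ε c K τ) {m k : ℕ} (hmk : m + k = Module.finrank ℝ W)
    (hm : ∀ x ∈ A, ∃ S : Submodule ℝ W, Module.finrank ℝ S = m ∧ ∀ u ∈ S, 0 ≤ q x u)
    (hk : ∀ x ∈ A, ∃ S : Submodule ℝ W, Module.finrank ℝ S = k ∧ ∀ u ∈ S, q x u ≤ 0)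
    (hx : x ∈ A) :
    IsCompl (h.reverse.stable x) (h.stable x) ∧
      Module.finrank ℝ (h.reverse.stable x) = k ∧ Module.finrank ℝ (h.stable x) = m := by
  obtain ⟨S, hS, hSV⟩ := h.exists_submodule_le_stable hm hx
  obtain ⟨S', hS', hSH⟩ := h.reverse.exists_submodule_le_stable (m := k)
    (fun x hx => by
      obtain ⟨S, hS, hSq⟩ := hk x hx
      exact ⟨S, hS, fun u hu => neg_nonneg.2 (hSq u hu)⟩) hx
  have h1 := Submodule.finrank_mono hSV
  have h2 := Submodule.finrank_mono hSH
  have hdisj : Disjoint (h.reverse.stable x) (h.stable x) := by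
    rw [Submodule.disjoint_def]
    intro u hu hu'
    by_contra hne
    have hpos := h.length_pos x u hne
    have hr : 0 < ε / c := div_pos h.eps_pos h.c_pos
    set C := contractionConst lam ε c K τ
    set C' := contractionConst (-lam) ε c K τ
    have hle : ∀ t : ℝ, 0 ≤ t → 1 ≤ C' * C * Real.exp (-(2 * (ε / c) * t)) := by
      intro t ht
      have e1 := h.length_le_of_mem_stable hx hu' ht
      have e2 := h.length_le_of_mem_stable_reverse hx hu ht
      have hC' : 0 ≤ C' := by
        have := h.eps_pos; have := h.c_pos; have := h.tau_pos
        simp only [C', contractionConst]; positivity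
      have e5 : N x u ≤ C' * C * Real.exp (-(2 * (ε / c) * t)) * N x u := by
        calc N x u ≤ C' * Real.exp (-(2 * -lam + ε / c) * t) *
              (C * Real.exp (-(2 * lam + ε / c) * t) * N x u) := e2.trans (by gcongr)
          _ = C' * C * (Real.exp (-(2 * -lam + ε / c) * t) *
              Real.exp (-(2 * lam + ε / c) * t)) * N x u := by ring
          _ = _ := by rw [← Real.exp_add]; ring_nf
      exact le_of_mul_le_mul_right (by linarith) hpos
    have hlim : Tendsto (fun t => C' * C * Real.exp (-(2 * (ε / c) * t))) atTop (𝓝 0) := by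
      have := (Real.tendsto_exp_neg_atTop_nhds_zero.comp
        (tendsto_id.const_mul_atTop (show 0 < 2 * (ε / c) by positivity))).const_mul (C' * C)
      simpa [Function.comp_def] using this
    obtain ⟨t, ht1, ht2⟩ := ((hlim.eventually_lt_const one_pos).and (eventually_ge_atTop 0)).exists
    exact absurd (hle t ht2) (not_le.2 ht1)
  have h3 := Submodule.finrank_sup_add_finrank_inf_eq (h.reverse.stable x) (h.stable x)
  rw [hdisj.eq_bot, finrank_bot, add_zero] at h3
  have h4 := Submodule.finrank_le (h.reverse.stable x ⊔ h.stable x)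
  refine ⟨⟨hdisj, codisjoint_iff.2 (Submodule.eq_top_of_finrank_eq ?_)⟩, ?_, ?_⟩ <;> omega

end IsDissipativeCocycle

end Cocycle

/-! ### The flow on the manifold and vector fields in charts -/

section Flow

variable {n : ℕ} {X : Type*} [TopologicalSpace X] [ChartedSpace (E n) X]
  {f : ∀ x : X, TangentSpace 𝓘(ℝ, E n) x} {s t : ℝ} {x y z : X}

theorem Reaches.eq_of_zero (h : Reaches f 0 x y) : y = x := by
  obtain ⟨γ, a, b, -, -, -, h0, h1⟩ := h
  rw [← h0, ← h1]

theorem Reaches.flow_reaches (h : Reaches f t x y) : Reaches f t x (flow f t x) := by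
  have h' : ∃ y, Reaches f t x y := ⟨y, h⟩
  rw [flow, dif_pos h']
  exact h'.choose_spec

variable [T2Space X] [IsManifold 𝓘(ℝ, E n) ∞ X]

theorem Reaches.unique
    (hf : ContMDiff 𝓘(ℝ, E n) 𝓘(ℝ, E n).tangent 1
      (fun x => (⟨x, f x⟩ : TangentBundle 𝓘(ℝ, E n) X)))
    (h : Reaches f t x y) (h' : Reaches f t x z) : y = z := by
  obtain ⟨γ, a, b, h0, ht, hγ, rfl, rfl⟩ := h
  obtain ⟨γ', a', b', h0', ht', hγ', h1, rfl⟩ := h'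
  have := isMIntegralCurveOn_Ioo_eqOn_of_contMDiff_boundaryless (I := 𝓘(ℝ, E n))
    (a := max a a') (b := min b b') (t₀ := 0)
    ⟨max_lt h0.1 h0'.1, lt_min h0.2 h0'.2⟩ hf
    (hγ.mono (Ioo_subset_Ioo (le_max_left _ _) (min_le_left _ _)))
    (hγ'.mono (Ioo_subset_Ioo (le_max_right _ _) (min_le_right _ _))) h1.symm
  exact this ⟨max_lt ht.1 ht'.1, lt_min ht.2 ht'.2⟩

theorem Reaches.flow_eq
    (hf : ContMDiff 𝓘(ℝ, E n) 𝓘(ℝ, E n).tangent 1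
      (fun x => (⟨x, f x⟩ : TangentBundle 𝓘(ℝ, E n) X)))
    (h : Reaches f t x y) : flow f t x = y :=
  h.flow_reaches.unique hf h

theorem Reaches.trans
    (hf : ContMDiff 𝓘(ℝ, E n) 𝓘(ℝ, E n).tangent 1
      (fun x => (⟨x, f x⟩ : TangentBundle 𝓘(ℝ, E n) X)))
    (h : Reaches f t x y) (h' : Reaches f s y z) : Reaches f (s + t) x z := by
  obtain ⟨γ, a, b, h0, ht, hγ, rfl, rfl⟩ := h
  obtain ⟨γ', a', b', h0', ht', hγ', h1, rfl⟩ := h'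
  have hshift : IsMIntegralCurveOn (I := 𝓘(ℝ, E n)) (γ' ∘ (· - t)) f (Ioo (a' + t) (b' + t)) := by
    refine (isMIntegralCurveOn_comp_sub.2 hγ').mono fun s hs => ?_
    rw [mem_ofPred_eq]
    exact ⟨by linarith [hs.1], by linarith [hs.2]⟩
  have hmem : t ∈ Ioo a b ∩ Ioo (a' + t) (b' + t) :=
    ⟨ht, by linarith [h0'.1], by linarith [h0'.2]⟩
  have hagree : γ t = (γ' ∘ (· - t)) t := by simp [h1]
  have hglue := isMIntegralCurveOn_piecewise hf hγ hshift hmem hagree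
  have heq := eqOn_piecewise_of_isMIntegralCurveOn_Ioo hf hγ hshift hmem hagree
  have hst : s + t ∈ Ioo (a' + t) (b' + t) := ⟨by linarith [ht'.1], by linarith [ht'.2]⟩
  refine ⟨_, min a (a' + t), max b (b' + t), ⟨?_, ?_⟩, ⟨?_, ?_⟩, hglue.mono ?_, ?_, ?_⟩
  · exact min_lt_of_left_lt h0.1
  · exact lt_max_of_lt_left h0.2
  · exact min_lt_of_right_lt hst.1
  · exact lt_max_of_lt_right hst.2
  · rw [Ioo_union_Ioo']
    · exact hmem.2.1.trans ht.2
    · exact ht.1.trans hmem.2.2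
  · exact piecewise_eq_of_mem _ _ _ h0
  · rw [heq hst]
    simp

end Flow

section Chart

variable {n : ℕ} {X : Type*} [TopologicalSpace X] [ChartedSpace (E n) X]
  {f : ∀ x : X, TangentSpace 𝓘(ℝ, E n) x} {φ : OpenPartialHomeomorph X (E n)} {x y : X}

theorem contMDiffAt_chart (hφ : φ ∈ IsManifold.maximalAtlas 𝓘(ℝ, E n) ∞ X) (hx : x ∈ φ.source) :
    ContMDiffAt 𝓘(ℝ, E n) 𝓘(ℝ, E n) ∞ φ x :=
  contMDiffAt_of_mem_maximalAtlas hφ hx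

theorem mdifferentiableAt_chart (hφ : φ ∈ IsManifold.maximalAtlas 𝓘(ℝ, E n) ∞ X)
    (hx : x ∈ φ.source) : MDifferentiableAt 𝓘(ℝ, E n) 𝓘(ℝ, E n) φ x :=
  (contMDiffAt_chart hφ hx).mdifferentiableAt (by simp)

theorem mdifferentiableAt_chart_symm (hφ : φ ∈ IsManifold.maximalAtlas 𝓘(ℝ, E n) ∞ X) {ξ : E n}
    (hξ : ξ ∈ φ.target) : MDifferentiableAt 𝓘(ℝ, E n) 𝓘(ℝ, E n) φ.symm ξ :=
  (contMDiffAt_symm_of_mem_maximalAtlas hφ hξ).mdifferentiableAt (by simp)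

theorem coord_injective (hφ : φ ∈ IsManifold.maximalAtlas 𝓘(ℝ, E n) ∞ X) (hx : x ∈ φ.source) :
    Function.Injective (coord φ x) := by
  have hmd : φ.MDifferentiable 𝓘(ℝ, E n) 𝓘(ℝ, E n) :=
    ⟨fun y hy => (mdifferentiableAt_chart hφ hy).mdifferentiableWithinAt,
      fun y hy => (mdifferentiableAt_chart_symm hφ hy).mdifferentiableWithinAt⟩
  exact hmd.mfderiv_injective hx

variable [IsManifold 𝓘(ℝ, E n) ∞ X]

theorem contDiffOn_localField
    (hf : ContMDiff 𝓘(ℝ, E n) 𝓘(ℝ, E n).tangent 1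
      (fun x => (⟨x, f x⟩ : TangentBundle 𝓘(ℝ, E n) X)))
    (hφ : φ ∈ IsManifold.maximalAtlas 𝓘(ℝ, E n) ∞ X) :
    ContDiffOn ℝ 1 (localField f φ) φ.target := by
  have h1 : ContMDiffOn 𝓘(ℝ, E n).tangent 𝓘(ℝ, E n).tangent 1
      (tangentMapWithin 𝓘(ℝ, E n) 𝓘(ℝ, E n) φ φ.source)
      (Bundle.TotalSpace.proj ⁻¹' φ.source) :=
    (contMDiffOn_of_mem_maximalAtlas hφ).contMDiffOn_tangentMapWithin (by decide)
      φ.open_source.uniqueMDiffOn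
  have h2 : ContMDiffOn 𝓘(ℝ, E n) 𝓘(ℝ, E n).tangent 1
      (fun ξ => (⟨φ.symm ξ, f (φ.symm ξ)⟩ : TangentBundle 𝓘(ℝ, E n) X)) φ.target :=
    hf.comp_contMDiffOn ((contMDiffOn_symm_of_mem_maximalAtlas hφ).of_le (by simp))
  have h3 := (contMDiff_snd_tangentBundle_modelSpace (E n) 𝓘(ℝ, E n)).comp_contMDiffOn
    (h1.comp h2 (fun ξ hξ => φ.map_target hξ))
  rw [← contMDiffOn_iff_contDiffOn]
  refine h3.congr fun ξ hξ => ?_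
  exact DFunLike.congr_fun (mfderivWithin_of_isOpen φ.open_source (φ.map_target hξ)).symm
    (f (φ.symm ξ))

end Chart

/-! ### The differential of the flow in charts -/

section FlowChart

variable {n : ℕ} {X : Type*} [TopologicalSpace X] [ChartedSpace (E n) X]
  {f : ∀ x : X, TangentSpace 𝓘(ℝ, E n) x} {φ : OpenPartialHomeomorph X (E n)} {x y : X}

theorem mfderiv_symm_coord (hφ : φ ∈ IsManifold.maximalAtlas 𝓘(ℝ, E n) ∞ X)
    (hx : x ∈ φ.source) (u : TangentSpace 𝓘(ℝ, E n) x) :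
    mfderiv 𝓘(ℝ, E n) 𝓘(ℝ, E n) φ.symm (φ x) (coord φ x u) = u := by
  have hmd : φ.MDifferentiable 𝓘(ℝ, E n) 𝓘(ℝ, E n) :=
    ⟨fun y hy => (mdifferentiableAt_chart hφ hy).mdifferentiableWithinAt,
      fun y hy => (mdifferentiableAt_chart_symm hφ hy).mdifferentiableWithinAt⟩
  exact DFunLike.congr_fun (hmd.symm_comp_deriv hx) u

/-- Solutions of the equation in a chart are integral curves on the manifold. -/
theorem isMIntegralCurveOn_chart_symm (hφ : φ ∈ IsManifold.maximalAtlas 𝓘(ℝ, E n) ∞ X)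
    {c : ℝ → E n} {s : Set ℝ} (hc : ∀ t ∈ s, c t ∈ φ.target)
    (hd : ∀ t ∈ s, HasDerivAt c (localField f φ (c t)) t) :
    IsMIntegralCurveOn (I := 𝓘(ℝ, E n)) (φ.symm ∘ c) f s := by
  intro t ht
  have h1 := (mdifferentiableAt_chart_symm hφ (hc t ht)).hasMFDerivAt
  have h2 : HasMFDerivAt 𝓘(ℝ, ℝ) 𝓘(ℝ, E n) c t
      (ContinuousLinearMap.smulRight (1 : ℝ →L[ℝ] ℝ) (localField f φ (c t))) :=
    (hd t ht).hasFDerivAt.hasMFDerivAt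
  have h3 := (h1.comp t h2).hasMFDerivWithinAt (s := s)
  have h4 : mfderiv 𝓘(ℝ, E n) 𝓘(ℝ, E n) φ.symm (c t) (localField f φ (c t)) = f (φ.symm (c t)) := by
    have := mfderiv_symm_coord hφ (φ.map_target (hc t ht)) (f (φ.symm (c t)))
    rw [φ.right_inv (hc t ht)] at this
    exact this
  have h5 : ((1 : ℝ →L[ℝ] ℝ).smulRight (f (φ.symm (c t)) : E n)) =
      ContinuousLinearMap.comp (mfderiv 𝓘(ℝ, E n) 𝓘(ℝ, E n) φ.symm (c t) : E n →L[ℝ] E n)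
        ((1 : ℝ →L[ℝ] ℝ).smulRight (localField f φ (c t))) := by
    refine ContinuousLinearMap.ext fun r => ?_
    exact ((map_smul (mfderiv 𝓘(ℝ, E n) 𝓘(ℝ, E n) φ.symm (c t) : E n →L[ℝ] E n) r _).trans
      (congrArg (r • ·) h4)).symm
  exact h5.symm ▸ h3

variable [T2Space X] [IsManifold 𝓘(ℝ, E n) ∞ X]

/-- Near any point the flow exists for short times and is differentiable; in a chart, its
differential is the fundamental solution of the variational equation. -/
theorem exists_flow_chart
    (hf : ContMDiff 𝓘(ℝ, E n) 𝓘(ℝ, E n).tangent 1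
      (fun x => (⟨x, f x⟩ : TangentBundle 𝓘(ℝ, E n) X)))
    (hφ : φ ∈ IsManifold.maximalAtlas 𝓘(ℝ, E n) ∞ X) (hx : x ∈ φ.source) {U : Set X}
    (hU : U ∈ 𝓝 x) :
    ∃ W ∈ 𝓝 x, ∃ δ > 0, ∃ (L : ℝ≥0) (M : X → ℝ → E n →L[ℝ] E n), ∀ y ∈ W, y ∈ φ.source ∧
      M y 0 = ContinuousLinearMap.id ℝ (E n) ∧ HasDerivAt (M y) (linearization f φ y) 0 ∧
      ∀ t ∈ Ioo (-δ) δ, Reaches f t y (flow f t y) ∧ flow f t y ∈ U ∧ flow f t y ∈ φ.source ∧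
        MDifferentiableAt 𝓘(ℝ, E n) 𝓘(ℝ, E n) (flow f t) y ∧
        (∀ u, coord φ (flow f t y) (dflow f t y u) = M y t (coord φ y u)) ∧ ‖M y t‖ ≤ L := by
  have hF : ContDiffAt ℝ 1 (localField f φ) (φ x) :=
    (contDiffOn_localField hf hφ).contDiffAt (φ.open_target.mem_nhds (φ.map_source hx))
  have hU' : φ.target ∩ φ.symm ⁻¹' U ∈ 𝓝 (φ x) := by
    refine inter_mem (φ.open_target.mem_nhds (φ.map_source hx)) ?_
    refine (φ.continuousAt_symm (φ.map_source hx)).preimage_mem_nhds ?_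
    rwa [φ.left_inv hx]
  obtain ⟨r, hr, δ, hδ, L, Φ, M, h⟩ := exists_localFlow hF hU'
  set W := φ.source ∩ φ ⁻¹' ball (φ x) r
  have hW : IsOpen W := φ.isOpen_inter_preimage isOpen_ball
  have hreach : ∀ y ∈ W, ∀ t ∈ Ioo (-δ) δ, Reaches f t y (φ.symm (Φ (φ y) t)) := by
    intro y hy t ht
    obtain ⟨h0, -, -, hΦ⟩ := h (φ y) hy.2
    refine ⟨φ.symm ∘ Φ (φ y), -δ, δ, ⟨by linarith, hδ⟩, ht,
      isMIntegralCurveOn_chart_symm hφ (fun s hs => (hΦ s hs).1.1) (fun s hs => (hΦ s hs).2.1),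
      ?_, rfl⟩
    simp [h0, φ.left_inv hy.1]
  refine ⟨W, hW.mem_nhds ⟨hx, mem_ball_self hr⟩, δ, hδ, L, fun y => M (φ y), fun y hy => ?_⟩
  obtain ⟨h0, hM0, hM, hΦ⟩ := h (φ y) hy.2
  refine ⟨hy.1, hM0, hM, fun t ht => ?_⟩
  have hflow : ∀ z ∈ W, flow f t z = φ.symm (Φ (φ z) t) := fun z hz =>
    (hreach z hz t ht).flow_eq hf
  obtain ⟨hmem, hdt, hfd, hL⟩ := hΦ t ht
  have h1 : HasMFDerivAt 𝓘(ℝ, E n) 𝓘(ℝ, E n) (fun z => Φ (φ z) t) y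
      ((M (φ y) t).comp (coord φ y)) :=
    HasMFDerivAt.comp y hfd.hasMFDerivAt (mdifferentiableAt_chart hφ hy.1).hasMFDerivAt
  have hev : ∀ᶠ z in 𝓝 y, z ∈ W := hW.mem_nhds hy
  have hmd : MDifferentiableAt 𝓘(ℝ, E n) 𝓘(ℝ, E n) (flow f t) y := by
    have h2 := HasMFDerivAt.comp y (mdifferentiableAt_chart_symm hφ hmem.1).hasMFDerivAt h1
    exact (h2.congr_of_eventuallyEq (hev.mono hflow)).mdifferentiableAt
  have hsrc : flow f t y ∈ φ.source := by
    rw [hflow y hy]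
    exact φ.map_target hmem.1
  refine ⟨(hreach y hy t ht).flow_reaches, ?_, hsrc, hmd, fun u => ?_, hL⟩
  · rw [hflow y hy]
    exact hmem.2
  · have h2 := HasMFDerivAt.comp y (mdifferentiableAt_chart hφ hsrc).hasMFDerivAt hmd.hasMFDerivAt
    have hev2 : φ ∘ flow f t =ᶠ[𝓝 y] fun z => Φ (φ z) t := by
      filter_upwards [hev] with z hz
      rw [Function.comp_apply, hflow z hz, φ.right_inv ((h (φ z) hz.2).2.2.2 t ht).1.1]
    have h3 := h1.congr_of_eventuallyEq hev2
    exact DFunLike.congr_fun (hasMFDerivAt_unique h2 h3) u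

end FlowChart

/-! ### Riemannian length and coordinates -/

section Metric

variable {n : ℕ} {X : Type*} [TopologicalSpace X] [ChartedSpace (E n) X]
  {φ ψ : OpenPartialHomeomorph X (E n)} {x : X}

/-- Coordinates in two charts are locally comparable. -/
theorem exists_norm_coord_le_norm_coord (hφ : φ ∈ IsManifold.maximalAtlas 𝓘(ℝ, E n) ∞ X)
    (hψ : ψ ∈ IsManifold.maximalAtlas 𝓘(ℝ, E n) ∞ X) (hxφ : x ∈ φ.source) (hxψ : x ∈ ψ.source) :
    ∃ C > 0, ∀ᶠ y in 𝓝 x, ∀ u, ‖coord φ y u‖ ≤ C * ‖coord ψ y u‖ := by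
  have hsmooth : ContDiffAt ℝ ∞ (φ ∘ ψ.symm) (ψ x) := by
    rw [← contMDiffAt_iff_contDiffAt]
    refine ContMDiffAt.comp _ ?_ (contMDiffAt_symm_of_mem_maximalAtlas hψ (ψ.map_source hxψ))
    rw [ψ.left_inv hxψ]
    exact contMDiffAt_chart hφ hxφ
  have hcont : ContinuousAt (fun y => ‖fderiv ℝ (φ ∘ ψ.symm) (ψ y)‖) x :=
    (ContinuousAt.comp (f := ψ) (hsmooth.continuousAt_fderiv (by simp))
      (ψ.continuousAt hxψ)).norm
  refine ⟨‖fderiv ℝ (φ ∘ ψ.symm) (ψ x)‖ + 1, by positivity, ?_⟩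
  filter_upwards [hcont.eventually_lt_const (lt_add_one _), φ.open_source.mem_nhds hxφ,
    ψ.open_source.mem_nhds hxψ] with y hy hyφ hyψ u
  have h1 : MDifferentiableAt 𝓘(ℝ, E n) 𝓘(ℝ, E n) (φ ∘ ψ.symm) (ψ y) := by
    refine MDifferentiableAt.comp (I' := 𝓘(ℝ, E n)) _ ?_
      (mdifferentiableAt_chart_symm hψ (ψ.map_source hyψ))
    rw [ψ.left_inv hyψ]
    exact mdifferentiableAt_chart hφ hyφ
  have h2 := HasMFDerivAt.comp y (mdifferentiableAt_iff_differentiableAt.1 h1).hasFDerivAt.hasMFDerivAt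
    (mdifferentiableAt_chart hψ hyψ).hasMFDerivAt
  have h3 : (φ ∘ ψ.symm) ∘ ψ =ᶠ[𝓝 y] φ := by
    filter_upwards [ψ.open_source.mem_nhds hyψ] with z hz
    simp [ψ.left_inv hz]
  have h4 : coord φ y u = fderiv ℝ (φ ∘ ψ.symm) (ψ y) (coord ψ y u) :=
    DFunLike.congr_fun (hasMFDerivAt_unique (mdifferentiableAt_chart hφ hyφ).hasMFDerivAt
      (h2.congr_of_eventuallyEq h3.symm)) u
  rw [h4]
  exact ((fderiv ℝ (φ ∘ ψ.symm) (ψ y)).le_opNorm _).trans (by gcongr)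

open Bundle in
/-- The trivialization of the tangent bundle at `x` is the differential of the preferred chart, and it
is locally bounded together with its inverse. -/
theorem exists_norm_coord_chartAt_le [IsManifold 𝓘(ℝ, E n) 1 X]
    [RiemannianBundle (fun x : X => TangentSpace 𝓘(ℝ, E n) x)]
    [IsContinuousRiemannianBundle (E n) (fun x : X => TangentSpace 𝓘(ℝ, E n) x)] (x : X) :
    ∃ C > 0, ∀ᶠ y in 𝓝 x, ∀ u : TangentSpace 𝓘(ℝ, E n) y,
      ‖coord (chartAt (E n) x) y u‖ ≤ C * ‖u‖ ∧ ‖u‖ ≤ C * ‖coord (chartAt (E n) x) y u‖ := by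
  obtain ⟨C, hC, h⟩ := eventually_norm_trivializationAt_lt (E n)
    (fun x : X => TangentSpace 𝓘(ℝ, E n) x) x
  obtain ⟨C', hC', h'⟩ := eventually_norm_symmL_trivializationAt_lt (E n)
    (fun x : X => TangentSpace 𝓘(ℝ, E n) x) x
  refine ⟨max C C', by positivity, ?_⟩
  filter_upwards [h, h', (chartAt (E n) x).open_source.mem_nhds (mem_chart_source _ x)]
    with y hy hy' hyx u
  have hbase : y ∈ (trivializationAt (E n) (fun x : X => TangentSpace 𝓘(ℝ, E n) x) x).baseSet :=
    hyx
  have h1 : (trivializationAt (E n) (fun x : X => TangentSpace 𝓘(ℝ, E n) x) x).continuousLinearMapAt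
      ℝ y u = coord (chartAt (E n) x) y u :=
    DFunLike.congr_fun (TangentBundle.continuousLinearMapAt_trivializationAt hyx) u
  have h2 := (trivializationAt (E n) (fun x : X => TangentSpace 𝓘(ℝ, E n) x) x).symmL_continuousLinearMapAt
    (R := ℝ) hbase u
  constructor
  · rw [← h1]
    refine (ContinuousLinearMap.le_opNorm _ u).trans ?_
    gcongr
    exact hy.le.trans (le_max_left _ _)
  · rw [← h1]
    nth_rw 1 [← h2]
    refine (ContinuousLinearMap.le_opNorm _ _).trans ?_
    gcongr
    exact hy'.le.trans (le_max_right _ _)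

variable [IsManifold 𝓘(ℝ, E n) ∞ X]

open Bundle in
/-- The Riemannian length of a tangent vector and the Euclidean length of its coordinates are
locally comparable. -/
theorem exists_norm_coord_le_inner (g : RiemMetric n X)
    (hφ : φ ∈ IsManifold.maximalAtlas 𝓘(ℝ, E n) ∞ X) (hx : x ∈ φ.source) :
    ∃ C > 0, ∀ᶠ y in 𝓝 x, ∀ u : TangentSpace 𝓘(ℝ, E n) y,
      ‖coord φ y u‖ ^ 2 ≤ C * g.inner y u u ∧ g.inner y u u ≤ C * ‖coord φ y u‖ ^ 2 := by
  let : RiemannianBundle (fun x : X => TangentSpace 𝓘(ℝ, E n) x) :=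
    ⟨g.toContinuousRiemannianMetric.toRiemannianMetric⟩
  have : IsContinuousRiemannianBundle (E n) (fun x : X => TangentSpace 𝓘(ℝ, E n) x) := inferInstance
  have hatlas := IsManifold.chart_mem_maximalAtlas (I := 𝓘(ℝ, E n)) (n := ∞) x
  obtain ⟨C₁, hC₁, h₁⟩ := exists_norm_coord_chartAt_le (n := n) x
  obtain ⟨C₂, hC₂, h₂⟩ := exists_norm_coord_le_norm_coord hφ hatlas hx (mem_chart_source _ x)
  obtain ⟨C₃, hC₃, h₃⟩ := exists_norm_coord_le_norm_coord hatlas hφ (mem_chart_source _ x) hx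
  refine ⟨(C₁ * (C₂ + C₃)) ^ 2, by positivity, ?_⟩
  filter_upwards [h₁, h₂, h₃] with y e₁ e₂ e₃ u
  have hN : g.inner y u u = ‖u‖ ^ 2 := real_inner_self_eq_norm_sq u
  rw [hN, ← mul_pow, ← mul_pow]
  have hu := norm_nonneg u
  have hφu := norm_nonneg (coord φ y u)
  constructor
  · gcongr
    calc ‖coord φ y u‖ ≤ C₂ * (C₁ * ‖u‖) := (e₂ u).trans (by gcongr; exact (e₁ u).1)
      _ ≤ C₁ * (C₂ + C₃) * ‖u‖ := by nlinarith [mul_nonneg (mul_nonneg hC₁.le hC₃.le) hu]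
  · gcongr
    calc ‖u‖ ≤ C₁ * (C₃ * ‖coord φ y u‖) := (e₁ u).2.trans (by gcongr; exact e₃ u)
      _ ≤ C₁ * (C₂ + C₃) * ‖coord φ y u‖ := by
        nlinarith [mul_nonneg (mul_nonneg hC₁.le hC₂.le) hφu]

end Metric

/-! ### Quadratic forms of given inertia -/

section Form

variable {n p : ℕ} {P : Matrix (Fin n) (Fin n) ℝ}

theorem form_eq_inner (P : Matrix (Fin n) (Fin n) ℝ) (u v : E n) :
    form P u v = inner ℝ u (Matrix.toEuclideanCLM (n := Fin n) (𝕜 := ℝ) P v) := by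
  rw [EuclideanSpace.inner_eq_star_dotProduct, Matrix.ofLp_toEuclideanCLM, form, dotProduct_comm]
  simp

theorem exists_abs_form_le (P : Matrix (Fin n) (Fin n) ℝ) :
    ∃ C > 0, ∀ u : E n, |form P u u| ≤ C * ‖u‖ ^ 2 := by
  set B := Matrix.toEuclideanCLM (n := Fin n) (𝕜 := ℝ) P
  refine ⟨‖B‖ + 1, by positivity, fun u => ?_⟩
  rw [form_eq_inner]
  calc |inner ℝ u (B u)| ≤ ‖u‖ * ‖B u‖ := abs_real_inner_le_norm _ _
    _ ≤ ‖u‖ * (‖B‖ * ‖u‖) := by gcongr; exact B.le_opNorm u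
    _ ≤ (‖B‖ + 1) * ‖u‖ ^ 2 := by nlinarith [sq_nonneg ‖u‖]

theorem hasDerivAt_form {z : ℝ → E n} {z' : E n} {t : ℝ} (hz : HasDerivAt z z' t) :
    HasDerivAt (fun s => form P (z s) (z s)) (form P z' (z t) + form P (z t) z') t := by
  simp only [form_eq_inner]
  have := hz.inner ℝ
    ((Matrix.toEuclideanCLM (n := Fin n) (𝕜 := ℝ) P).hasFDerivAt.comp_hasDerivAt t hz)
  rwa [add_comm] at this

theorem form_self_eq_sum (hP : P.IsHermitian) (u : E n) :
    form P u u = ∑ i, hP.eigenvalues i * hP.eigenvectorBasis.repr u i ^ 2 := by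
  set b := hP.eigenvectorBasis
  have h1 : ∀ i, Matrix.toEuclideanCLM (n := Fin n) (𝕜 := ℝ) P (b i) = hP.eigenvalues i • b i := by
    intro i
    ext j
    have := congrFun (hP.mulVec_eigenvectorBasis i) j
    simpa [Matrix.ofLp_toEuclideanCLM] using this
  have h2 : Matrix.toEuclideanCLM (n := Fin n) (𝕜 := ℝ) P u =
      ∑ i, b.repr u i • hP.eigenvalues i • b i := by
    conv_lhs => rw [← b.sum_repr u]
    simp only [map_sum, map_smul, h1]
  rw [form_eq_inner, h2, inner_sum]
  refine Finset.sum_congr rfl fun i _ => ?_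
  rw [inner_smul_right, inner_smul_right, real_inner_comm, ← b.repr_apply_apply]
  ring

/-- On the span of a set of eigenvectors the form is the corresponding weighted sum of squares. -/
theorem exists_submodule_form (hP : P.IsHermitian) (s : Finset (Fin n)) :
    ∃ S : Submodule ℝ (E n), Module.finrank ℝ S = s.card ∧
      ∀ u ∈ S, form P u u = ∑ i ∈ s, hP.eigenvalues i * hP.eigenvectorBasis.repr u i ^ 2 := by
  set b := hP.eigenvectorBasis
  refine ⟨Submodule.span ℝ (b.toBasis '' s), ?_, fun u hu => ?_⟩
  · have hli : LinearIndependent ℝ fun i : s => b.toBasis i :=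
      b.toBasis.linearIndependent.comp _ Subtype.val_injective
    have := finrank_span_eq_card hli
    rw [Fintype.card_coe] at this
    rw [← this, image_eq_range]
    rfl
  · rw [form_self_eq_sum hP]
    refine (Finset.sum_subset (Finset.subset_univ s) fun i _ hi => ?_).symm
    have h1 := b.toBasis.mem_span_image.1 hu
    have h2 : b.toBasis.repr u i = 0 := by
      by_contra hne
      exact hi (h1 (Finsupp.mem_support_iff.2 hne))
    have h3 : b.repr u i = 0 := by simpa using h2
    rw [h3]
    ring

theorem HasInertia.le (h : HasInertia P p) : p ≤ n := by
  obtain ⟨_, hcard, -⟩ := h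
  rw [← hcard]
  exact (Finset.card_le_univ _).trans (Fintype.card_fin n).le

theorem HasInertia.exists_submodule_nonneg (h : HasInertia P p) :
    ∃ S : Submodule ℝ (E n), Module.finrank ℝ S = n - p ∧ ∀ u ∈ S, 0 ≤ form P u u := by
  obtain ⟨hP, -, hcard⟩ := h
  obtain ⟨S, hS, hform⟩ := exists_submodule_form hP {i | 0 < hP.eigenvalues i}
  refine ⟨S, hS.trans hcard, fun u hu => ?_⟩
  rw [hform u hu]
  exact Finset.sum_nonneg fun i hi => mul_nonneg (Finset.mem_filter.1 hi).2.le (sq_nonneg _)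

theorem HasInertia.exists_submodule_nonpos (h : HasInertia P p) :
    ∃ S : Submodule ℝ (E n), Module.finrank ℝ S = p ∧ ∀ u ∈ S, form P u u ≤ 0 := by
  obtain ⟨hP, hcard, -⟩ := h
  obtain ⟨S, hS, hform⟩ := exists_submodule_form hP {i | hP.eigenvalues i < 0}
  refine ⟨S, hS.trans hcard, fun u hu => ?_⟩
  rw [hform u hu]
  exact Finset.sum_nonpos fun i hi =>
    mul_nonpos_of_nonpos_of_nonneg (Finset.mem_filter.1 hi).2.le (sq_nonneg _)

end Form

/-! ### The dissipation inequality along the flow -/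

section Dominated

variable {n p : ℕ} {X : Type*} [TopologicalSpace X] [ChartedSpace (E n) X]
  {T : ∀ x : X, TangentSpace 𝓘(ℝ, E n) x →L[ℝ] TangentSpace 𝓘(ℝ, E n) x →L[ℝ] ℝ}
  {P : Matrix (Fin n) (Fin n) ℝ} {φ : OpenPartialHomeomorph X (E n)} {x : X}

/-- Coordinates carry the inertia of `P` over to the tensor at each point. -/
theorem exists_tensor_submodule (hP : HasInertia P p) (hφ : IsAdaptedChart T P φ)
    (hx : x ∈ φ.source) :
    (∃ S : Submodule ℝ (E n), Module.finrank ℝ S = n - p ∧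
      ∀ u ∈ S, 0 ≤ T x (u : E n) (u : E n)) ∧
    ∃ S : Submodule ℝ (E n), Module.finrank ℝ S = p ∧
      ∀ u ∈ S, T x (u : E n) (u : E n) ≤ 0 := by
  let L : E n →L[ℝ] E n := coord φ x
  have hinj : Function.Injective L.toLinearMap := coord_injective hφ.1 hx
  let e : E n ≃ₗ[ℝ] E n :=
    LinearEquiv.ofBijective L.toLinearMap ⟨hinj, LinearMap.injective_iff_surjective.1 hinj⟩
  have hT : ∀ v : E n, T x (e.symm v : E n) (e.symm v : E n) = form P v v := fun v => by
    have he : L (e.symm v) = v := e.apply_symm_apply v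
    exact (hφ.2 x hx _ _).trans (congrArg₂ (form P) he he)
  constructor
  · obtain ⟨S, hS, hSf⟩ := hP.exists_submodule_nonneg
    refine ⟨S.map (e.symm : E n →ₗ[ℝ] E n), (LinearEquiv.finrank_map_eq e.symm S).trans hS, ?_⟩
    rintro _ ⟨v, hv, rfl⟩
    exact (hSf v hv).trans_eq (hT v).symm
  · obtain ⟨S, hS, hSf⟩ := hP.exists_submodule_nonpos
    refine ⟨S.map (e.symm : E n →ₗ[ℝ] E n), (LinearEquiv.finrank_map_eq e.symm S).trans hS, ?_⟩
    rintro _ ⟨v, hv, rfl⟩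
    exact (hT v).trans_le (hSf v hv)

variable [T2Space X] [IsManifold 𝓘(ℝ, E n) ∞ X] {g : RiemMetric n X}
  {f : ∀ x : X, TangentSpace 𝓘(ℝ, E n) x} {lam ε : ℝ} {A : Set X}

/-- Near each point the tensor is bounded by the metric, and short-time flow maps exist, are
differentiable and expand lengths by a bounded factor. -/
theorem exists_local_bounds
    (hf : ContMDiff 𝓘(ℝ, E n) 𝓘(ℝ, E n).tangent 1
      (fun x => (⟨x, f x⟩ : TangentBundle 𝓘(ℝ, E n) X)))
    (hφ : IsAdaptedChart T P φ) (hx : x ∈ φ.source) :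
    ∃ δ > 0, ∃ K > 0, ∀ᶠ y in 𝓝 x, (∀ u, |T y u u| ≤ K * g.inner y u u) ∧
      ∀ t, |t| ≤ δ → (∃ z, Reaches f t y z) ∧
        MDifferentiableAt 𝓘(ℝ, E n) 𝓘(ℝ, E n) (flow f t) y ∧
        ∀ u, g.inner (flow f t y) (dflow f t y u) (dflow f t y u) ≤ K * g.inner y u u := by
  obtain ⟨C, hC, hg⟩ := exists_norm_coord_le_inner g hφ.1 hx
  obtain ⟨B, hB, hP⟩ := exists_abs_form_le P
  obtain ⟨W, hW, δ, hδ, L, M, h⟩ := exists_flow_chart hf hφ.1 hx hg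
  refine ⟨δ / 2, by positivity, B * C + C * ((L + 1) ^ 2 * C), by positivity, ?_⟩
  filter_upwards [hW, hg] with y hyW hyg
  obtain ⟨hyφ, -, -, hflow⟩ := h y hyW
  have hpos : ∀ u, 0 ≤ g.inner y u u := fun u =>
    nonneg_of_mul_nonneg_right ((sq_nonneg _).trans (hyg u).1) hC
  refine ⟨fun u => ?_, fun t ht => ?_⟩
  · rw [hφ.2 y hyφ]
    calc |form P (coord φ y u) (coord φ y u)| ≤ B * ‖coord φ y u‖ ^ 2 := hP _
      _ ≤ B * (C * g.inner y u u) := by gcongr; exact (hyg u).1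
      _ ≤ _ := by
        have : 0 ≤ C * ((L + 1) ^ 2 * C) * g.inner y u u := mul_nonneg (by positivity) (hpos u)
        linarith
  · obtain ⟨hr, hU, -, hmd, hM, hL⟩ := hflow t (by
      rw [mem_Ioo, ← abs_lt]; linarith)
    rw [mem_ofPred_eq] at hU
    refine ⟨⟨_, hr⟩, hmd, fun u => ?_⟩
    have h1 : ‖M y t (coord φ y u)‖ ≤ (L + 1) * ‖coord φ y u‖ :=
      ((M y t).le_opNorm _).trans (by gcongr; linarith)
    calc g.inner (flow f t y) (dflow f t y u) (dflow f t y u)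
        ≤ C * ‖coord φ (flow f t y) (dflow f t y u)‖ ^ 2 := (hU _).2
      _ = C * ‖M y t (coord φ y u)‖ ^ 2 := by rw [hM]
      _ ≤ C * ((L + 1) * ‖coord φ y u‖) ^ 2 := by gcongr
      _ = C * ((L + 1) ^ 2 * ‖coord φ y u‖ ^ 2) := by ring
      _ ≤ C * ((L + 1) ^ 2 * (C * g.inner y u u)) := by gcongr; exact (hyg u).1
      _ ≤ _ := by
        have : 0 ≤ B * C * g.inner y u u := mul_nonneg (by positivity) (hpos u)
        linarith

/-- By compactness the local bounds hold uniformly along `A`. -/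
theorem exists_uniform_bounds
    (hf : ContMDiff 𝓘(ℝ, E n) 𝓘(ℝ, E n).tangent 1
      (fun x => (⟨x, f x⟩ : TangentBundle 𝓘(ℝ, E n) X)))
    (hcover : ∀ x : X, ∃ φ : OpenPartialHomeomorph X (E n), x ∈ φ.source ∧ IsAdaptedChart T P φ)
    (hA : IsCompact A) :
    ∃ δ > 0, ∃ K > 0, ∀ x ∈ A, ∀ᶠ y in 𝓝 x, (∀ u, |T y u u| ≤ K * g.inner y u u) ∧
      ∀ t, |t| ≤ δ → (∃ z, Reaches f t y z) ∧
        MDifferentiableAt 𝓘(ℝ, E n) 𝓘(ℝ, E n) (flow f t) y ∧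
        ∀ u, g.inner (flow f t y) (dflow f t y u) (dflow f t y u) ≤ K * g.inner y u u := by
  have hg : ∀ y u, 0 ≤ g.inner y u u := fun y u => by
    rcases eq_or_ne u 0 with rfl | hu
    · simp
    · exact (g.pos y u hu).le
  refine hA.induction_on (p := fun s => ∃ δ > 0, ∃ K > 0, ∀ x ∈ s, ∀ᶠ y in 𝓝 x,
      (∀ u, |T y u u| ≤ K * g.inner y u u) ∧
      ∀ t, |t| ≤ δ → (∃ z, Reaches f t y z) ∧
        MDifferentiableAt 𝓘(ℝ, E n) 𝓘(ℝ, E n) (flow f t) y ∧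
        ∀ u, g.inner (flow f t y) (dflow f t y u) (dflow f t y u) ≤ K * g.inner y u u)
    ⟨1, one_pos, 1, one_pos, by simp⟩
    (fun s s' hs ⟨δ, hδ, K, hK, h⟩ => ⟨δ, hδ, K, hK, fun x hx => h x (hs hx)⟩) ?_ ?_
  · rintro s s' ⟨δ, hδ, K, hK, h⟩ ⟨δ', hδ', K', hK', h'⟩
    refine ⟨min δ δ', lt_min hδ hδ', max K K', lt_max_of_lt_left hK, fun x hx => ?_⟩
    have hle : ∀ (y : X) u, K * g.inner y u u ≤ max K K' * g.inner y u u := fun y u =>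
      mul_le_mul_of_nonneg_right (le_max_left _ _) (hg y u)
    have hle' : ∀ (y : X) u, K' * g.inner y u u ≤ max K K' * g.inner y u u := fun y u =>
      mul_le_mul_of_nonneg_right (le_max_right _ _) (hg y u)
    rcases hx with hx | hx
    · filter_upwards [h x hx] with y hy
      refine ⟨fun u => (hy.1 u).trans (hle y u), fun t ht => ?_⟩
      obtain ⟨h1, h2, h3⟩ := hy.2 t (ht.trans (min_le_left _ _))
      exact ⟨h1, h2, fun u => (h3 u).trans (hle y u)⟩
    · filter_upwards [h' x hx] with y hy
      refine ⟨fun u => (hy.1 u).trans (hle' y u), fun t ht => ?_⟩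
      obtain ⟨h1, h2, h3⟩ := hy.2 t (ht.trans (min_le_right _ _))
      exact ⟨h1, h2, fun u => (h3 u).trans (hle' y u)⟩
  · intro x _
    obtain ⟨φ, hx, hφ⟩ := hcover x
    obtain ⟨δ, hδ, K, hK, h⟩ := exists_local_bounds (g := g) hf hφ hx
    exact ⟨_, mem_nhdsWithin_of_mem_nhds h.eventually_nhds, δ, hδ, K, hK, fun y hy => hy⟩

/-- Along the flow the tensor obeys the dissipation inequality: in an adapted chart the coordinates
of a transported vector solve the variational equation. -/
theorem exists_hasDerivAt_tensor
    (hf : ContMDiff 𝓘(ℝ, E n) 𝓘(ℝ, E n).tangent 1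
      (fun x => (⟨x, f x⟩ : TangentBundle 𝓘(ℝ, E n) X)))
    (hφ : IsAdaptedChart T P φ) (hx : x ∈ φ.source) (hd : Dissipation g f P lam ε φ)
    (u : TangentSpace 𝓘(ℝ, E n) x) :
    ∃ d, HasDerivAt (fun t => T (flow f t x) (dflow f t x u) (dflow f t x u)) d 0 ∧
      d ≤ -(2 * lam) * T x u u - ε * g.inner x u u := by
  obtain ⟨W, hW, δ, hδ, L, M, h⟩ := exists_flow_chart hf hφ.1 hx univ_mem
  obtain ⟨-, hM0, hM, hflow⟩ := h x (mem_of_mem_nhds hW)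
  have h1 : HasDerivAt (fun t => M x t (coord φ x u)) (linearization f φ x (coord φ x u)) 0 := by
    simpa using hM.clm_apply (hasDerivAt_const (0 : ℝ) (coord φ x u))
  have h2 := hasDerivAt_form (P := P) h1
  have hev : ∀ᶠ t in 𝓝 (0 : ℝ), t ∈ Ioo (-δ) δ := Ioo_mem_nhds (by linarith) hδ
  refine ⟨_, h2.congr_of_eventuallyEq ?_, ?_⟩
  · filter_upwards [hev] with t ht
    obtain ⟨-, -, hs, -, hMt, -⟩ := hflow t ht
    rw [hφ.2 _ hs, hMt]
  · have h3 := hd x hx u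
    have h4 : len g u ^ 2 = g.inner x u u := by
      refine Real.sq_sqrt ?_
      rcases eq_or_ne u 0 with rfl | hu
      · simp
      · exact (g.pos x u hu).le
    rw [h4] at h3
    rw [hM0, hφ.2 x hx]
    simp only [ContinuousLinearMap.id_apply]
    linarith

end Dominated

/-! ### The cocycle over a compact invariant set -/

section InvariantSet

variable {n p : ℕ} {X : Type*} [TopologicalSpace X] [ChartedSpace (E n) X]
  {f : ∀ x : X, TangentSpace 𝓘(ℝ, E n) x} {A : Set X} {x : X}

/-- This holds everywhere: at time `0` the junk value of the flow agrees with the true one. -/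
theorem flow_zero (f : ∀ x : X, TangentSpace 𝓘(ℝ, E n) x) : flow f 0 = id := by
  funext x
  by_cases h : ∃ y, Reaches f 0 x y
  · exact h.choose_spec.flow_reaches.eq_of_zero
  · exact dif_neg h

theorem dflow_zero_apply (f : ∀ x : X, TangentSpace 𝓘(ℝ, E n) x) (x : X)
    (u : TangentSpace 𝓘(ℝ, E n) x) : (dflow f 0 x u : E n) = u := by
  have h : HasMFDerivAt 𝓘(ℝ, E n) 𝓘(ℝ, E n) (flow f 0) x
      (ContinuousLinearMap.id ℝ (TangentSpace 𝓘(ℝ, E n) x)) :=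
    (hasMFDerivAt_id x).congr_of_eventuallyEq (Eventually.of_forall fun y => by rw [flow_zero])
  exact DFunLike.congr_fun (hasMFDerivAt_unique h.mdifferentiableAt.hasMFDerivAt h) u

variable [T2Space X] [IsManifold 𝓘(ℝ, E n) ∞ X]

theorem flow_add (hf : ContMDiff 𝓘(ℝ, E n) 𝓘(ℝ, E n).tangent 1
      (fun x => (⟨x, f x⟩ : TangentBundle 𝓘(ℝ, E n) X))) {s t : ℝ}
    (ht : ∃ y, Reaches f t x y) (hs : ∃ y, Reaches f s (flow f t x) y) :
    flow f (s + t) x = flow f s (flow f t x) :=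
  (ht.choose_spec.flow_reaches.trans hf hs.choose_spec.flow_reaches).flow_eq hf

/-- If the flow is regular along `A` for short times, it is regular for all times, as a composition
of short-time flows. -/
theorem mdifferentiableAt_flow_of_short_time
    (hf : ContMDiff 𝓘(ℝ, E n) 𝓘(ℝ, E n).tangent 1
      (fun x => (⟨x, f x⟩ : TangentBundle 𝓘(ℝ, E n) X)))
    (hinv : IsInvariant f A) {δ : ℝ} (hδ : 0 < δ)
    (h : ∀ x ∈ A, ∀ t, |t| ≤ δ → (∀ᶠ y in 𝓝 x, ∃ z, Reaches f t y z) ∧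
      MDifferentiableAt 𝓘(ℝ, E n) 𝓘(ℝ, E n) (flow f t) x) (t : ℝ) :
    ∀ x ∈ A, (∀ᶠ y in 𝓝 x, ∃ z, Reaches f t y z) ∧
      MDifferentiableAt 𝓘(ℝ, E n) 𝓘(ℝ, E n) (flow f t) x := by
  obtain ⟨k, hk⟩ := exists_nat_ge (|t| / δ)
  have hτ : |t / (k + 1)| ≤ δ := by
    have hk0 : (0 : ℝ) < k + 1 := by positivity
    rw [abs_div, abs_of_pos hk0, div_le_iff₀ hk0]
    rw [div_le_iff₀ hδ] at hk
    nlinarith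
  set τ := t / (k + 1)
  have key : ∀ m : ℕ, ∀ x ∈ A, (∀ᶠ y in 𝓝 x, ∃ z, Reaches f (m * τ) y z) ∧
      MDifferentiableAt 𝓘(ℝ, E n) 𝓘(ℝ, E n) (flow f (m * τ)) x := by
    intro m
    induction m with
    | zero =>
      intro x hx
      simpa using h x hx 0 (by simpa using hδ.le)
    | succ m ih =>
      intro x hx
      obtain ⟨hr, hmd⟩ := ih x hx
      obtain ⟨hr', hmd'⟩ := h (flow f (m * τ) x) (hinv x hx _).2 τ hτ
      have hev : ∀ᶠ y in 𝓝 x, (∃ z, Reaches f (m * τ) y z) ∧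
          ∃ z, Reaches f τ (flow f (m * τ) y) z :=
        hr.and (hmd.continuousAt.eventually hr')
      have heq : ((m + 1 : ℕ) : ℝ) * τ = τ + m * τ := by push_cast; ring
      rw [heq]
      refine ⟨?_, ?_⟩
      · filter_upwards [hev] with y ⟨h1, h2⟩
        exact ⟨_, h1.choose_spec.flow_reaches.trans hf h2.choose_spec⟩
      · refine (hmd'.comp x hmd).congr_of_eventuallyEq ?_
        filter_upwards [hev] with y ⟨h1, h2⟩
        exact flow_add hf h1 h2
  have ht : ((k + 1 : ℕ) : ℝ) * τ = t := by
    simp only [τ]; push_cast; field_simp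
  rw [← ht]
  exact key (k + 1)

theorem dflow_add_apply
    (hf : ContMDiff 𝓘(ℝ, E n) 𝓘(ℝ, E n).tangent 1
      (fun x => (⟨x, f x⟩ : TangentBundle 𝓘(ℝ, E n) X)))
    (hinv : IsInvariant f A)
    (h : ∀ t, ∀ x ∈ A, (∀ᶠ y in 𝓝 x, ∃ z, Reaches f t y z) ∧
      MDifferentiableAt 𝓘(ℝ, E n) 𝓘(ℝ, E n) (flow f t) x) (hx : x ∈ A) (s t : ℝ)
    (u : TangentSpace 𝓘(ℝ, E n) x) :
    (dflow f (s + t) x u : E n) = dflow f s (flow f t x) (dflow f t x u) := by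
  obtain ⟨hr, hmd⟩ := h t x hx
  obtain ⟨hr', hmd'⟩ := h s (flow f t x) (hinv x hx _).2
  have h1 := (hmd'.hasMFDerivAt.comp x hmd.hasMFDerivAt).congr_of_eventuallyEq
    (f₁ := flow f (s + t)) (by
      filter_upwards [hr, hmd.continuousAt.eventually hr'] with y h1 h2
      exact flow_add hf h1 h2)
  exact DFunLike.congr_fun (hasMFDerivAt_unique (h (s + t) x hx).2.hasMFDerivAt h1) u

variable {g : RiemMetric n X} {lam ε : ℝ}
  {T : ∀ x : X, TangentSpace 𝓘(ℝ, E n) x →L[ℝ] TangentSpace 𝓘(ℝ, E n) x →L[ℝ] ℝ}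
  {P : Matrix (Fin n) (Fin n) ℝ}

/-- Over a compact invariant set, the differential of the flow of a strictly dominant system is a
dissipative cocycle for the tensor `T`. -/
theorem exists_isDissipativeCocycle
    (hf : ContMDiff 𝓘(ℝ, E n) 𝓘(ℝ, E n).tangent 1
      (fun x => (⟨x, f x⟩ : TangentBundle 𝓘(ℝ, E n) X))) (hε : 0 < ε)
    (hcover : ∀ x : X, ∃ φ : OpenPartialHomeomorph X (E n), x ∈ φ.source ∧
      IsAdaptedChart T P φ ∧ Dissipation g f P lam ε φ)
    (hA : IsCompact A) (hinv : IsInvariant f A) :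
    ∃ K τ : ℝ, IsDissipativeCocycle (W := E n) A (flow f) (fun t x => dflow f t x)
      (fun x u => g.inner x u u) (fun x u => T x u u) lam ε K K τ := by
  obtain ⟨δ, hδ, K, hK, hb⟩ := exists_uniform_bounds (g := g) (T := T) (P := P) hf
    (fun x => (hcover x).imp fun φ h => ⟨h.1, h.2.1⟩) hA
  have hreg := mdifferentiableAt_flow_of_short_time hf hinv hδ fun x hx t ht =>
    ⟨(hb x hx).mono fun y hy => (hy.2 t ht).1, ((hb x hx).self_of_nhds.2 t ht).2.1⟩
  have hnn : ∀ (x : X) (u : TangentSpace 𝓘(ℝ, E n) x), 0 ≤ g.inner x u u := fun x u => by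
    rcases eq_or_ne u 0 with rfl | hu
    · simp
    · exact (g.pos x u hu).le
  refine ⟨K, δ, hε, hK, hK, hδ, fun x hx t => (hinv x hx t).2, fun x _ => by rw [flow_zero]; rfl,
    fun x hx s t => flow_add hf (hinv x hx t).1 (hinv _ (hinv x hx t).2 s).1,
    fun x _ => ContinuousLinearMap.ext fun u => dflow_zero_apply f x u,
    fun x hx s t => ContinuousLinearMap.ext fun u => dflow_add_apply hf hinv hreg hx s t u,
    fun x u hu => g.pos x u hu, fun x r u => ?_, fun x u v => ?_, fun x _ => ?_,
    fun x hx u => (hb x hx).self_of_nhds.1 u,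
    fun x hx u t ht => ((hb x hx).self_of_nhds.2 t ht).2.2 u, fun x _ u => ?_⟩
  · have : ∀ u : TangentSpace 𝓘(ℝ, E n) x,
        g.inner x (r • u) (r • u) = r ^ 2 * g.inner x u u := fun u => by
      simp only [map_smul, smul_apply, smul_eq_mul]
      ring
    exact this u
  · have : ∀ u v : TangentSpace 𝓘(ℝ, E n) x,
        g.inner x (u + v) (u + v) ≤ 2 * g.inner x u u + 2 * g.inner x v v := fun u v => by
      have h1 := hnn x (u - v)
      simp only [map_sub, map_add, add_apply, sub_apply] at h1 ⊢
      linarith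
    exact this u v
  · let B : E n →L[ℝ] E n →L[ℝ] ℝ := T x
    exact B.continuous.clm_apply continuous_id
  · obtain ⟨φ, hx, hφ, hd⟩ := hcover x
    exact exists_hasDerivAt_tensor hf hφ hx hd u

theorem sqrt_le_of_le_exp {a b C μ t : ℝ} (hb : 0 ≤ b) (h : a ≤ C * Real.exp (-(2 * μ) * t) * b) :
    √a ≤ √(max 1 C) * Real.exp (-μ * t) * √b := by
  refine Real.sqrt_le_iff.2 ⟨by positivity, h.trans ?_⟩
  rw [mul_pow, mul_pow, Real.sq_sqrt (by positivity), Real.sq_sqrt hb, ← Real.exp_nat_mul]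
  have h1 : ((2 : ℕ) : ℝ) * (-μ * t) = -(2 * μ) * t := by push_cast; ring
  rw [h1]
  gcongr
  exact le_max_right _ _

end InvariantSet

end Dominance

open Dominance in
theorem theorem1 {n p : ℕ} {X : Type*} [TopologicalSpace X] [T2Space X]
    [ChartedSpace (E n) X] [IsManifold 𝓘(ℝ, E n) ∞ X] (g : RiemMetric n X)
    (f : ∀ x : X, TangentSpace 𝓘(ℝ, E n) x)
    (hf : ContMDiff 𝓘(ℝ, E n) 𝓘(ℝ, E n).tangent 1
      (fun x => (⟨x, f x⟩ : TangentBundle 𝓘(ℝ, E n) X)))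
    (lam : ℝ)
    (T : ∀ x : X, TangentSpace 𝓘(ℝ, E n) x →L[ℝ] TangentSpace 𝓘(ℝ, E n) x →L[ℝ] ℝ)
    (hdom : StrictlyDominant g f p lam T)
    (A : Set X) (hA : IsCompact A) (hinv : IsInvariant f A) :
    ∃ H V : ∀ x : X, Submodule ℝ (TangentSpace 𝓘(ℝ, E n) x),
      (∀ x ∈ A, IsCompl (H x) (V x) ∧
        Module.finrank ℝ (H x) = p ∧ Module.finrank ℝ (V x) = n - p) ∧
      (∀ x ∈ A, ∀ t : ℝ, ∀ u ∈ H x, dflow f t x u ∈ H (flow f t x)) ∧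
      (∀ x ∈ A, ∀ t : ℝ, ∀ u ∈ V x, dflow f t x u ∈ V (flow f t x)) ∧
      ∃ C₁ C₂ lam₁ lam₂ : ℝ, 0 < C₁ ∧ C₁ ≤ 1 ∧ 1 ≤ C₂ ∧ lam₁ < lam ∧ lam < lam₂ ∧
        (∀ x ∈ A, ∀ u ∈ H x, ∀ t : ℝ, 0 ≤ t →
          C₁ * Real.exp (-lam₁ * t) * len g u ≤ len g (dflow f t x u)) ∧
        (∀ x ∈ A, ∀ u ∈ V x, ∀ t : ℝ, 0 ≤ t →
          len g (dflow f t x u) ≤ C₂ * Real.exp (-lam₂ * t) * len g u) := by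
  obtain ⟨-, P, ε, hP, hε, hcover⟩ := hdom
  obtain ⟨K, τ, h⟩ := exists_isDissipativeCocycle hf hε hcover hA hinv
  have hμ : 0 < ε / K := div_pos h.eps_pos h.c_pos
  have hsplit : ∀ x ∈ A, IsCompl (h.reverse.stable x) (h.stable x) ∧
      Module.finrank ℝ (h.reverse.stable x) = p ∧ Module.finrank ℝ (h.stable x) = n - p :=
    fun x hx => h.isCompl_stable (m := n - p) (k := p)
      (by rw [finrank_euclideanSpace_fin]; exact Nat.sub_add_cancel hP.le)
      (fun y _ => by
        obtain ⟨φ, hy, hφ, -⟩ := hcover y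
        exact (exists_tensor_submodule hP hφ hy).1)
      (fun y _ => by
        obtain ⟨φ, hy, hφ, -⟩ := hcover y
        exact (exists_tensor_submodule hP hφ hy).2) hx
  obtain ⟨C, hCdef⟩ : ∃ C, C = IsDissipativeCocycle.contractionConst lam ε K K τ := ⟨_, rfl⟩
  obtain ⟨C', hC'def⟩ : ∃ C, C = IsDissipativeCocycle.contractionConst (-lam) ε K K τ := ⟨_, rfl⟩
  have hexp : -(2 * (lam + ε / K / 2)) = -(2 * lam + ε / K) := by ring
  have hexp' : -(2 * -(lam - ε / K / 2)) = -(2 * -lam + ε / K) := by ring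
  have hC : ∀ C : ℝ, 1 ≤ √(max 1 C) := fun C => Real.one_le_sqrt.2 (le_max_left _ _)
  refine ⟨fun x => h.reverse.stable x, fun x => h.stable x, hsplit,
    fun x hx t u hu => h.map_mem_stable_reverse hx hu t,
    fun x hx t u hu => h.map_mem_stable hx hu t, (√(max 1 C'))⁻¹, √(max 1 C),
    lam - ε / K / 2, lam + ε / K / 2, by have := hC C'; positivity, inv_le_one_of_one_le₀ (hC C'),
    hC C, by linarith, by linarith, fun x hx u hu t ht => ?_, fun x hx u hu t ht => ?_⟩
  · -- contraction in backward time, applied to the transported vector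
    have h4 : len g u ≤ √(max 1 C') * Real.exp (-(-(lam - ε / K / 2)) * t) *
        len g (dflow f t x u) :=
      sqrt_le_of_le_exp (h.length_nonneg _ _) (by
        rw [hexp', hC'def]; exact h.length_le_of_mem_stable_reverse hx hu ht)
    have h5 : Real.exp (-(lam - ε / K / 2) * t) * Real.exp (-(-(lam - ε / K / 2)) * t) = 1 := by
      rw [← Real.exp_add, ← Real.exp_zero]
      ring_nf
    have h6 : 0 < √(max 1 C') := zero_lt_one.trans_le (hC C')
    calc (√(max 1 C'))⁻¹ * Real.exp (-(lam - ε / K / 2) * t) * len g u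
        ≤ (√(max 1 C'))⁻¹ * Real.exp (-(lam - ε / K / 2) * t) *
          (√(max 1 C') * Real.exp (-(-(lam - ε / K / 2)) * t) * len g (dflow f t x u)) := by gcongr
      _ = ((√(max 1 C'))⁻¹ * √(max 1 C')) * (Real.exp (-(lam - ε / K / 2) * t) *
          Real.exp (-(-(lam - ε / K / 2)) * t)) * len g (dflow f t x u) := by ring
      _ = len g (dflow f t x u) := by rw [h5, inv_mul_cancel₀ h6.ne', one_mul, one_mul]
  · exact sqrt_le_of_le_exp (h.length_nonneg x u) (by
      rw [hexp, hCdef]; exact h.length_le_of_mem_stable hx hu ht)
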